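/- Let $K/F/\mathbb{Q}_p$ be finite field extensions with rings of integers $\mathcal{O}_K$, $\mathcal{O}_F$, let $\pi$ be a uniformizer of $\mathcal{O}_F$, let $q$ be the number of elements of $\mathcal{O}_F/(\pi)$, and let $A$ be a finite quotient ring of $\mathcal{O}_K$. Let $\Phi\in\mathcal{O}_F[[t]]$ be a Lubin--Tate series for $\pi$, that is, $\Phi(t)\equiv\pi t$ modulo $t^2$ and $\Phi(t)\equiv t^q$ modulo $\pi$. For $\gamma\in\mathcal{O}_F^\times$ let $[\gamma]_\Phi\in\mathcal{O}_F[[t]]$ be the unique power series with $[\gamma]_\Phi(t)\equiv\gamma t$ modulo $t^2$ and $\Phi\circ[\gamma]_\Phi=[\gamma]_\Phi\circ\Phi$. Let $D$ be a finite set. For a commutative $\mathcal{O}_F$-algebra $S$ put $S[[t_\bullet]]=S[[t_d]]_{d\in D}$. For $d\in D$ let $\varphi_d$, respectively $\gamma_d$ (for $\gamma\in\mathcal{O}_F^\times$), be the $S$-algebra endomorphism of $S[[t_\bullet]]$ given by substitution which sends $t_d$ to $\Phi(t_d)$, respectively to $[\gamma]_\Phi(t_d)$, and fixes $t_{d'}$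 for $d'\neq d$. A $\psi$-operator on $A[[t_\bullet]]$ is a family of additive maps $\psi_d:A[[t_\bullet]]\to A[[t_\bullet]]$ $(d\in D)$ such that for all $a,x\in A[[t_\bullet]]$: * $\psi_d(\gamma_{d'}x)=\gamma_{d'}\psi_d(x)$ for all $\gamma\in\mathcal{O}_F^\times$ and all $d,d'\in D$; * $\psi_d(t_{d'}x)=t_{d'}\psi_d(x)$ and $\psi_d(\varphi_{d'}(x))=\varphi_{d'}(\psi_d(x))$ for $d'\neq d$; * $\psi_d(\varphi_d(a)x)=a\,\psi_d(x)$. Then the following hold. 1. For each $d\in D$ the ring $\mathcal{O}_K[[t_\bullet]]$ is a free module of rank $q$ over its subring $\varphi_d(\mathcal{O}_K[[t_\bullet]])$. There is a $\psi$-operator on $A[[t_\bullet]]$ with every $\psi_d$ surjective such that $\psi_d$ is the reduction of $\pi^{-1}\varphi_d^{-1}\circ\mathrm{tr}$, where $\mathrm{tr}$ is the trace of $\mathcal{O}_K[[t_\bullet]]$ over $\varphi_d(\mathcal{O}_K[[t_\bullet]])$: for every $x\in\mathcal{O}_K[[t_\bullet]]$ there is $y\in\mathcal{O}_K[[t_\bullet]]$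 with $\mathrm{tr}(x)=\pi\varphi_d(y)$ and $\psi_d(\bar x)=\bar y$, where the bar denotes reduction to $A[[t_\bullet]]$. 2. If $\Phi(t)=\pi t+t^q$, then $q/\pi\in\mathcal{O}_F$, and the operator in 1 satisfies, for all $d\in D$, $m\ge 0$ and $0\le i\le q-1$, modulo $\pi A[[t_\bullet]]$: if $F\neq\mathbb{Q}_p$, $$\psi_d(t_d^{mq+i})\equiv\begin{cases}0& 0\le i\le q-2\\ t_d^m& i=q-1;\end{cases}$$ if $F=\mathbb{Q}_p$, $$\psi_d(t_d^{mq+i})\equiv\begin{cases}\frac{q}{\pi}t_d^m& i=0\\ 0& 1\le i\le q-2\\ t_d^m& i=q-1.\end{cases}$$ 3. If $F=\mathbb{Q}_p$, there is also a $\psi$-operator on $A[[t_\bullet]]$ with every $\psi_d$ surjective such that moreover $\psi_d(t_{d'})=t_{d'}$ whenever $d'\neq d$. -/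

import Mathlib

open scoped PowerSeries

noncomputable section

section Integers

/-- The integral closure of `R` in `L`, as a type. -/
def IntClosure (R L : Type*) [CommRing R] [CommRing L] [Algebra R L] : Type _ :=
  integralClosure R L

variable (R L : Type*) [CommRing R] [CommRing L] [Algebra R L]

instance : CommRing (IntClosure R L) := inferInstanceAs (CommRing (integralClosure R L))

instance : Algebra R (IntClosure R L) := inferInstanceAs (Algebra R (integralClosure R L))

instance (M : Type*) [CommRing M] [Algebra L M] : Algebra (IntClosure R L) M :=
  inferInstanceAs (Algebra (integralClosure R L) M)

/-- The ring of integers of a finite extension `F` of `ℚ_p`: the integral closure of `ℤ_p` in `F`. -/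
abbrev ringInt (p : ℕ) [Fact p.Prime] (F : Type*) [Field F] [Algebra ℤ_[p] F] : Type _ :=
  IntClosure ℤ_[p] F

/-- The ring of integers of a finite extension `K` of `F`: the integral closure of the ring of
integers of `F` in `K` (by transitivity, this is also the integral closure of `ℤ_p` in `K`). -/
abbrev ringIntExt (p : ℕ) [Fact p.Prime] (F : Type*) [Field F] [Algebra ℤ_[p] F]
    (K : Type*) [Field K] [Algebra F K] : Type _ :=
  IntClosure (ringInt p F) K

end Integers

section LubinTate

variable {R : Type*} [CommRing R]

/-- A Lubin-Tate power series for the uniformizer `π`: a series `Φ` with `Φ(t) ≡ π t` modulo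
degree two and `Φ(t) ≡ t ^ q` modulo `π`, where `q` is the number of elements of `R / (π)`. -/
structure LubinTateSeries (π : R) where
  toSeries : R⟦X⟧
  constantCoeff_eq : PowerSeries.constantCoeff toSeries = 0
  coeff_one_eq : PowerSeries.coeff 1 toSeries = π
  congr_pow : ∀ n, π ∣ PowerSeries.coeff n
    (toSeries - (PowerSeries.X : R⟦X⟧) ^ Nat.card (R ⧸ Ideal.span {π}))

/-- `f` is an endomorphism series with multiplier `γ`: `f ≡ γ t` modulo degree two, and
`Φ (f (t)) = f (Φ (t))`. (In Mathlib, `PowerSeries.subst a f` is the series `f (a)`.) -/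
def IsEndoSeries (Φ : R⟦X⟧) (γ : R) (f : R⟦X⟧) : Prop :=
  PowerSeries.constantCoeff f = 0 ∧ PowerSeries.coeff 1 f = γ ∧
    PowerSeries.subst f Φ = PowerSeries.subst Φ f

open Classical in
/-- The series `[γ]_Φ` which describes the action of `γ` in the Lubin-Tate group of `Φ`: the unique
series `f ≡ γ t` modulo degree two that commutes with `Φ`. (Existence and uniqueness are
the classical lemma of Lubin and Tate; the value `0` is never used for a Lubin-Tate series over
the ring of integers of a local field.) -/
def endoSeries (Φ : R⟦X⟧) (γ : R) : R⟦X⟧ :=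
  if h : ∃ f, IsEndoSeries Φ γ f then h.choose else 0

theorem constantCoeff_endoSeries (Φ : R⟦X⟧) (γ : R) :
    PowerSeries.constantCoeff (endoSeries Φ γ) = 0 := by
  unfold endoSeries
  split_ifs with h
  · exact h.choose_spec.1
  · simp

section Insert

variable {D : Type*} [Finite D] [DecidableEq D] (S : Type*) [CommRing S] [Algebra R S]

theorem hasSubst_insert (f : R⟦X⟧) (hf : PowerSeries.constantCoeff f = 0) (d : D) :
    MvPowerSeries.HasSubst (Function.update (MvPowerSeries.X : D → MvPowerSeries D S) d
      (PowerSeries.subst (MvPowerSeries.X d : MvPowerSeries D S) f)) := by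
  refine MvPowerSeries.hasSubst_of_constantCoeff_zero fun e => ?_
  rcases eq_or_ne e d with rfl | h
  · simp only [Function.update_self]
    exact PowerSeries.constantCoeff_subst_eq_zero (MvPowerSeries.constantCoeff_X e) f hf
  · simp [Function.update_of_ne h]

/-- The `S`-algebra endomorphism of `S[[t_e]]_{e ∈ D}` given by substitution, which sends `t_d` to
`f (t_d)` and `t_e` to `t_e` for `e ≠ d`. -/
def insertAt (f : R⟦X⟧) (hf : PowerSeries.constantCoeff f = 0) (d : D) :
    MvPowerSeries D S →ₐ[S] MvPowerSeries D S :=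
  MvPowerSeries.substAlgHom (hasSubst_insert S f hf d)

/-- The operator `φ_d`, with `t_d ↦ Φ (t_d)`. -/
def phi {π : R} (Φ : LubinTateSeries π) (d : D) : MvPowerSeries D S →ₐ[S] MvPowerSeries D S :=
  insertAt S Φ.toSeries Φ.constantCoeff_eq d

/-- The action of `γ`, placed in the `d`-th factor, with `t_d ↦ [γ]_Φ (t_d)`. -/
def gammaAct {π : R} (Φ : LubinTateSeries π) (γ : Rˣ) (d : D) :
    MvPowerSeries D S →ₐ[S] MvPowerSeries D S :=
  insertAt S (endoSeries Φ.toSeries (γ : R)) (constantCoeff_endoSeries _ _) d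

variable {S}

/-- A `ψ`-operator on `S[[t_e]]_{e ∈ D}`: additive maps `ψ_d` that commute with the action of all
`γ_{d'}`, with multiplication by `t_{d'}` and with `φ_{d'}` for `d' ≠ d`, and that satisfy
`ψ_d (φ_d (a) x) = a ψ_d (x)`. -/
structure IsPsiOperator {π : R} (Φ : LubinTateSeries π)
    (ψ : D → MvPowerSeries D S →+ MvPowerSeries D S) : Prop where
  comm_gamma : ∀ (γ : Rˣ) (d d' : D) (x : MvPowerSeries D S),
    ψ d (gammaAct S Φ γ d' x) = gammaAct S Φ γ d' (ψ d x)
  comm_var : ∀ d d' : D, d ≠ d' → ∀ x : MvPowerSeries D S,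
    ψ d (MvPowerSeries.X d' * x) = MvPowerSeries.X d' * ψ d x
  comm_phi : ∀ d d' : D, d ≠ d' → ∀ x : MvPowerSeries D S,
    ψ d (phi S Φ d' x) = phi S Φ d' (ψ d x)
  phi_mul : ∀ (d : D) (a x : MvPowerSeries D S), ψ d (phi S Φ d a * x) = a * ψ d x

end Insert

end LubinTate

end

/-! Write S for the integers of K. Modulo π the map φ_d is t_d ↦ t_d^q, and for that map every
series is uniquely ∑ φ_d(v_i) t_d^i with i < q: sort the exponents of t_d by their residue modulo q.
Hence G = `coordVec ∘ phiSum` is the identity modulo π. Power series over S have no π-torsion and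
are π-adically complete, so a Neumann series inverts G (`IsTorsionFreeComplete.bijective`), and 1,
…, t_d^(q-1) is a basis over the image of φ_d (`phiBasis`). In this basis the q diagonal entries of
multiplication by x all agree modulo π. As π divides q, the trace is divisible by π, which yields
ψ_d = `tracePsi`.

The identities for ψ_d are linearity and naturality of the trace. The map γ_d is an automorphism
that preserves the image of φ_d; for d' ≠ d the maps γ_{d'} and φ_{d'} fix t_d and commute with φ_d,
so they act coordinatewise. That [γ]_Φ exists is the lemma of Lubin and Tate
(`exists_isEndoSeries`).

Division by π costs one order of precision: ψ_d modulo π needs the coordinates modulo π², and there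
G⁻¹ ≡ 2 - G. This gives the explicit formulas, and also that ψ_d(t_d^(q-1)) is a unit, whence
surjectivity.

All these operators are S-linear and so descend to A = S/I. Finally ψ_d(1) = q/π, which is a unit
for F = ℚ_p and divisible by π otherwise; in the first case, dividing by it normalizes the operator.
-/

noncomputable section

/-! ### Inverting maps that are the identity modulo a -/

section Adic

variable {S M : Type*} [CommRing S] [AddCommGroup M] [Module S M]

/-- `M` has no `a`-torsion and is `a`-adically separated and complete; completeness is expressed by
the convergence of the series `∑ a ^ i • r i`. -/
structure IsTorsionFreeComplete (a : S) (M : Type*) [AddCommGroup M] [Module S M] : Prop where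
  eq_zero_of_smul : ∀ x : M, a • x = 0 → x = 0
  eq_zero_of_forall_pow : ∀ x : M, (∀ n : ℕ, ∃ y : M, x = a ^ n • y) → x = 0
  exists_sum : ∀ r : ℕ → M, ∃ s : M, ∀ n : ℕ, ∃ y : M,
    s = ∑ i ∈ Finset.range n, a ^ i • r i + a ^ n • y

namespace IsTorsionFreeComplete

theorem smul_left_cancel {a : S} (h : IsTorsionFreeComplete a M) {x y : M} (e : a • x = a • y) :
    x = y :=
  sub_eq_zero.mp (h.eq_zero_of_smul _ (by rw [smul_sub, e, sub_self]))

theorem pi {a : S} (h : IsTorsionFreeComplete a M) (ι : Type*) :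
    IsTorsionFreeComplete a (ι → M) where
  eq_zero_of_smul x hx := funext fun i => h.eq_zero_of_smul _ (congrFun hx i)
  eq_zero_of_forall_pow x hx := funext fun i => h.eq_zero_of_forall_pow _ fun n => by
    obtain ⟨y, rfl⟩ := hx n
    exact ⟨y i, rfl⟩
  exists_sum r := by
    choose s hs using fun i => h.exists_sum fun n => r n i
    choose y hy using hs
    refine ⟨s, fun n => ⟨fun i => y i n, ?_⟩⟩
    ext i
    simpa using hy i n

theorem mvPowerSeries {a : S} (h : IsTorsionFreeComplete a S) (D : Type*) :
    IsTorsionFreeComplete a (MvPowerSeries D S) :=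
  h.pi (D →₀ ℕ)

/-- A linear endomorphism of `M` that is the identity modulo `a` is bijective. -/
theorem bijective {a : S} (h : IsTorsionFreeComplete a M) (G : M →ₗ[S] M)
    (hG : ∀ v, ∃ w, G v = v + a • w) : Function.Bijective G := by
  constructor
  · rw [injective_iff_map_eq_zero]
    intro v hv
    have key : ∀ n : ℕ, ∃ y, v = a ^ n • y ∧ G y = 0 := by
      intro n
      induction n with
      | zero => exact ⟨v, by simp, hv⟩
      | succ n ih =>
        obtain ⟨y, rfl, hy⟩ := ih
        obtain ⟨w, hw⟩ := hG y
        have hyw : y = a • -w := by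
          rw [smul_neg, eq_neg_iff_add_eq_zero, ← hw, hy]
        refine ⟨-w, by rw [pow_succ, mul_smul, ← hyw], h.eq_zero_of_smul _ ?_⟩
        rw [← map_smul, ← hyw, hy]
    exact h.eq_zero_of_forall_pow v fun n => (key n).imp fun y hy => hy.1
  · intro v
    choose w hw using hG
    -- The Neumann series ∑ (1 - G)^n v: since 1 - G is divisible by a, its n-th term is a^n • r n.
    let r : ℕ → M := fun n => (fun x => -w x)^[n] v
    have hr : ∀ n, r n - G (r n) = a • r (n + 1) := fun n => by
      simp [r, Function.iterate_succ_apply', hw]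
    have hsum : ∀ n, v = G (∑ i ∈ Finset.range n, a ^ i • r i) + a ^ n • r n := by
      intro n
      induction n with
      | zero => simp [r]
      | succ n ih =>
        rw [Finset.sum_range_succ, map_add, map_smul, add_assoc, pow_succ, mul_smul, ← hr,
          ← smul_add, add_sub_cancel]
        exact ih
    obtain ⟨s, hs⟩ := h.exists_sum r
    refine ⟨s, sub_eq_zero.mp (h.eq_zero_of_forall_pow _ fun n => ?_)⟩
    obtain ⟨y, hy⟩ := hs n
    refine ⟨G y - r n, ?_⟩
    conv_lhs => rw [hy, hsum n]
    rw [map_add, map_smul, smul_sub]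
    abel

end IsTorsionFreeComplete

/-- The first two terms of the geometric series for the inverse of an endomorphism that is the
identity modulo `a`. -/
theorem exists_eq_two_smul_sub {a : S} (G : M →ₗ[S] M) (hG : ∀ v, ∃ w, G v = v + a • w)
    {u v : M} (h : G u = v) : ∃ w, u = (v + v - G v) + (a * a) • w := by
  obtain ⟨w, hw⟩ := hG u
  obtain ⟨w', hw'⟩ := hG w
  refine ⟨w', ?_⟩
  have hv : G v = v + a • (w + a • w') := by
    rw [← hw', ← map_smul, ← h, ← map_add, ← hw]
  rw [hv, ← h, hw, smul_add, smul_smul]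
  abel

end Adic

/-! ### Substitution in one variable -/

section Insert

variable {R : Type*} [CommRing R] {D : Type*} [Finite D] [DecidableEq D]
  {S : Type*} [CommRing S] [Algebra R S]

theorem MvPowerSeries.ker_map_mk_span_singleton {D S : Type*} [CommRing S] (a : S)
    (x : MvPowerSeries D S) :
    MvPowerSeries.map (Ideal.Quotient.mk (Ideal.span {a})) x = 0 ↔ ∃ y, x = a • y := by
  constructor
  · intro h
    have : ∀ n, ∃ c, a * c = MvPowerSeries.coeff n x := fun n => by
      have := congrArg (MvPowerSeries.coeff n) h
      rw [MvPowerSeries.coeff_map, map_zero, Ideal.Quotient.eq_zero_iff_mem,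
        Ideal.mem_span_singleton] at this
      obtain ⟨c, hc⟩ := this
      exact ⟨c, hc.symm⟩
    choose y hy using this
    exact ⟨y, MvPowerSeries.ext fun n => (hy n).symm⟩
  · rintro ⟨y, rfl⟩
    ext n
    simp

theorem coeff_subst_X {D : Type*} [DecidableEq D] (f : R⟦X⟧) (d : D) (e : D →₀ ℕ) :
    MvPowerSeries.coeff e (PowerSeries.subst (MvPowerSeries.X d : MvPowerSeries D S) f) =
      if e = Finsupp.single d (e d) then algebraMap R S (PowerSeries.coeff (e d) f) else 0 := by
  rw [PowerSeries.coeff_subst (PowerSeries.HasSubst.X d), finsum_eq_single _ (e d)]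
  · rw [MvPowerSeries.coeff_X_pow, Algebra.algebraMap_eq_smul_one]
    split_ifs <;> simp
  · intro n hn
    rw [MvPowerSeries.coeff_X_pow, if_neg, smul_zero]
    intro h
    apply hn
    rw [h]
    simp

theorem insertAt_apply (f : R⟦X⟧) (hf : PowerSeries.constantCoeff f = 0) (d : D)
    (x : MvPowerSeries D S) :
    insertAt S f hf d x = MvPowerSeries.subst (Function.update MvPowerSeries.X d
      (PowerSeries.subst (MvPowerSeries.X d : MvPowerSeries D S) f)) x := by
  rw [insertAt, MvPowerSeries.coe_substAlgHom]

@[simp]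
theorem insertAt_X_self (f : R⟦X⟧) (hf : PowerSeries.constantCoeff f = 0) (d : D) :
    insertAt S f hf d (MvPowerSeries.X d) = PowerSeries.subst (MvPowerSeries.X d) f := by
  rw [insertAt_apply, MvPowerSeries.subst_X (hasSubst_insert S f hf d), Function.update_self]

theorem insertAt_X_of_ne (f : R⟦X⟧) (hf : PowerSeries.constantCoeff f = 0) {d e : D} (h : e ≠ d) :
    insertAt S f hf d (MvPowerSeries.X e) = MvPowerSeries.X e := by
  rw [insertAt_apply, MvPowerSeries.subst_X (hasSubst_insert S f hf d), Function.update_of_ne h]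

theorem insertAt_subst (f : R⟦X⟧) (hf : PowerSeries.constantCoeff f = 0) (d e : D) (g : R⟦X⟧) :
    insertAt S f hf d (PowerSeries.subst (MvPowerSeries.X e : MvPowerSeries D S) g) =
      PowerSeries.subst (insertAt S f hf d (MvPowerSeries.X e)) g := by
  rw [insertAt_apply, insertAt_apply]
  exact MvPowerSeries.subst_comp_subst_apply (PowerSeries.HasSubst.X e).const
    (hasSubst_insert S f hf d) g

/-- A composite of substitutions is again a substitution, so identities between such composites need
only be checked on the variables. -/
theorem insertAt_insertAt (f g : R⟦X⟧) (hf : PowerSeries.constantCoeff f = 0)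
    (hg : PowerSeries.constantCoeff g = 0) (d e : D) (x : MvPowerSeries D S) :
    insertAt S f hf d (insertAt S g hg e x) =
      MvPowerSeries.subst (fun s => insertAt S f hf d (insertAt S g hg e (MvPowerSeries.X s))) x := by
  have h : (fun s => insertAt S f hf d (insertAt S g hg e (MvPowerSeries.X s))) =
      fun s => MvPowerSeries.subst (Function.update MvPowerSeries.X d
        (PowerSeries.subst (MvPowerSeries.X d : MvPowerSeries D S) f))
        (Function.update MvPowerSeries.X e
        (PowerSeries.subst (MvPowerSeries.X e : MvPowerSeries D S) g) s) := by
    funext s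
    rw [insertAt_apply g, MvPowerSeries.subst_X (hasSubst_insert S g hg e), insertAt_apply]
  rw [h, ← MvPowerSeries.subst_comp_subst_apply (hasSubst_insert S g hg e)
    (hasSubst_insert S f hf d), insertAt_apply, insertAt_apply]

theorem insertAt_comm_of_ne (f g : R⟦X⟧) (hf : PowerSeries.constantCoeff f = 0)
    (hg : PowerSeries.constantCoeff g = 0) {d e : D} (h : d ≠ e) (x : MvPowerSeries D S) :
    insertAt S f hf d (insertAt S g hg e x) = insertAt S g hg e (insertAt S f hf d x) := by
  rw [insertAt_insertAt, insertAt_insertAt]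
  congr 1
  funext s
  by_cases hd : s = d
  · subst hd
    rw [insertAt_X_of_ne g hg h, insertAt_X_self, insertAt_subst, insertAt_X_of_ne g hg h]
  · rw [insertAt_X_of_ne f hf hd]
    by_cases he : s = e
    · subst he
      rw [insertAt_X_self, insertAt_subst, insertAt_X_of_ne f hf hd]
    · rw [insertAt_X_of_ne g hg he, insertAt_X_of_ne f hf hd]

theorem subst_subst_X {D : Type*} (f g : R⟦X⟧) (hf : PowerSeries.constantCoeff f = 0) (d : D) :
    PowerSeries.subst (PowerSeries.subst (MvPowerSeries.X d : MvPowerSeries D S) f) g =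
      PowerSeries.subst (MvPowerSeries.X d) (PowerSeries.subst f g) :=
  (PowerSeries.subst_comp_subst_apply (PowerSeries.HasSubst.of_constantCoeff_zero' hf)
    (PowerSeries.HasSubst.X d) g).symm

theorem constantCoeff_subst_of_eq_zero {f g : R⟦X⟧} (hf : PowerSeries.constantCoeff f = 0)
    (hg : PowerSeries.constantCoeff g = 0) :
    PowerSeries.constantCoeff (PowerSeries.subst f g) = 0 :=
  PowerSeries.constantCoeff_subst_eq_zero hf g hg

theorem insertAt_comp_self (f g : R⟦X⟧) (hf : PowerSeries.constantCoeff f = 0)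
    (hg : PowerSeries.constantCoeff g = 0) (d : D) (x : MvPowerSeries D S) :
    insertAt S f hf d (insertAt S g hg d x) = insertAt S (PowerSeries.subst f g)
      (constantCoeff_subst_of_eq_zero hf hg) d x := by
  rw [insertAt_insertAt, insertAt_apply]
  congr 1
  funext s
  by_cases hd : s = d
  · subst hd
    rw [Function.update_self, insertAt_X_self, insertAt_subst, insertAt_X_self,
      subst_subst_X f g hf]
  · rw [insertAt_X_of_ne g hg hd, insertAt_X_of_ne f hf hd, Function.update_of_ne hd]

theorem insertAt_X_series (d : D) (h : PowerSeries.constantCoeff (PowerSeries.X : R⟦X⟧) = 0)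
    (x : MvPowerSeries D S) : insertAt S PowerSeries.X h d x = x := by
  rw [insertAt_apply, PowerSeries.subst_X (PowerSeries.HasSubst.X d), Function.update_eq_self,
    MvPowerSeries.subst_self, id]

theorem insertAt_congr {f g : R⟦X⟧} (hfg : f = g) (hf : PowerSeries.constantCoeff f = 0)
    (hg : PowerSeries.constantCoeff g = 0) (d : D) :
    insertAt S f hf d = insertAt S g hg d := by
  subst hfg; rfl

theorem map_insertAt {S' : Type*} [CommRing S'] [Algebra R S'] (h : S →+* S')
    (hh : ∀ r, h (algebraMap R S r) = algebraMap R S' r) (f : R⟦X⟧)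
    (hf : PowerSeries.constantCoeff f = 0) (d : D) (x : MvPowerSeries D S) :
    MvPowerSeries.map h (insertAt S f hf d x) = insertAt S' f hf d (MvPowerSeries.map h x) := by
  rw [insertAt_apply, insertAt_apply, MvPowerSeries.map_subst (hasSubst_insert S f hf d)]
  congr 1
  funext s
  by_cases hd : s = d
  · subst hd
    ext n
    rw [Function.update_self, Function.update_self, MvPowerSeries.coeff_map, coeff_subst_X,
      coeff_subst_X, apply_ite h, hh, map_zero]
  · rw [Function.update_of_ne hd, Function.update_of_ne hd, MvPowerSeries.map_X]

/-- Allows Φ to be replaced by t^q when S is killed by π, although the two differ over R. -/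
theorem insertAt_eq_of_forall_algebraMap {f g : R⟦X⟧} (hf : PowerSeries.constantCoeff f = 0)
    (hg : PowerSeries.constantCoeff g = 0)
    (h : ∀ n, algebraMap R S (PowerSeries.coeff n f) = algebraMap R S (PowerSeries.coeff n g))
    (d : D) (x : MvPowerSeries D S) : insertAt S f hf d x = insertAt S g hg d x := by
  rw [insertAt_apply, insertAt_apply]
  congr 2
  ext n
  rw [coeff_subst_X, coeff_subst_X, h]

end Insert

/-! ### Sorting exponents by residue modulo q -/

section Coord

variable {D : Type*} {S : Type*} [CommRing S]

/-- The `i`-th coordinate of a power series in the basis `1, t_d, …, t_d ^ (q - 1)` over the power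
series in `t_d ^ q` and the other variables. -/
def coord (q : ℕ) (d : D) (i : ℕ) : MvPowerSeries D S →ₗ[S] MvPowerSeries D S where
  toFun x n := MvPowerSeries.coeff (n.update d (q * n d + i)) x
  map_add' x y := by ext n; exact map_add (MvPowerSeries.coeff _) x y
  map_smul' c x := by ext n; exact map_smul (MvPowerSeries.coeff _) c x

theorem coeff_coord (q : ℕ) (d : D) (i : ℕ) (n : D →₀ ℕ) (x : MvPowerSeries D S) :
    MvPowerSeries.coeff n (coord q d i x) = MvPowerSeries.coeff (n.update d (q * n d + i)) x :=
  rfl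

theorem map_coord {S' : Type*} [CommRing S'] (h : S →+* S') (q : ℕ) (d : D) (i : ℕ)
    (x : MvPowerSeries D S) :
    MvPowerSeries.map h (coord q d i x) = coord q d i (MvPowerSeries.map h x) := by
  ext n
  simp [coeff_coord]

/-- The shift by j carries residue class 0 to class j. This is why all diagonal entries of a
multiplication agree modulo π. -/
theorem coord_mul_X_pow_self (q : ℕ) (d : D) (j : ℕ) (x : MvPowerSeries D S) :
    coord q d j (x * MvPowerSeries.X d ^ j) = coord q d 0 x := by
  classical
  ext n
  have : n.update d (q * n d + j) = n.update d (q * n d + 0) + Finsupp.single d j := by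
    ext e
    by_cases h : e = d
    · subst h; simp
    · simp [Function.update_of_ne h, Finsupp.single_eq_of_ne h]
  rw [coeff_coord, coeff_coord, this, MvPowerSeries.X_pow_eq, MvPowerSeries.coeff_add_mul_monomial,
    mul_one]

/-- Division of the exponent of t_d by q with remainder. This injectivity of `coordVec` passes
bijectivity from `coordVec ∘ phiSum` to `phiSum`. -/
theorem eq_of_forall_coord {q : ℕ} (hq : 0 < q) (d : D) {x y : MvPowerSeries D S}
    (h : ∀ i < q, coord q d i x = coord q d i y) : x = y := by
  classical
  ext n
  have := congrArg (MvPowerSeries.coeff (n.update d (n d / q))) (h (n d % q) (Nat.mod_lt _ hq))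
  rw [coeff_coord, coeff_coord] at this
  have e : (n.update d (n d / q)).update d (q * (n.update d (n d / q)) d + n d % q) = n := by
    ext e
    by_cases h : e = d
    · subst h; simp [Nat.div_add_mod]
    · simp [Function.update_of_ne h]
  rwa [e] at this

theorem coord_X_pow (q : ℕ) (d : D) (m i j : ℕ) (hi : i < q) (hj : j < q) :
    coord q d j (MvPowerSeries.X d ^ (q * m + i) : MvPowerSeries D S) =
      if i = j then MvPowerSeries.X d ^ m else 0 := by
  classical
  ext n
  rw [coeff_coord, MvPowerSeries.coeff_X_pow]
  have key : n.update d (q * n d + j) = Finsupp.single d (q * m + i) ↔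
      i = j ∧ n = Finsupp.single d m := by
    constructor
    · intro h
      have h0 : q * n d + j = q * m + i := by simpa using DFunLike.congr_fun h d
      have hij : i = j := by
        have := congrArg (· % q) h0
        simpa [Nat.mod_eq_of_lt hi, Nat.mod_eq_of_lt hj, Nat.mul_add_mod] using this.symm
      refine ⟨hij, ?_⟩
      subst hij
      have hm : n d = m := Nat.eq_of_mul_eq_mul_left (by omega) (Nat.add_right_cancel h0)
      ext e
      by_cases he : e = d
      · subst he; simp [hm]
      · have := DFunLike.congr_fun h e
        simpa [Function.update_of_ne he, Finsupp.single_eq_of_ne he] using this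
    · rintro ⟨rfl, rfl⟩
      ext e
      by_cases he : e = d
      · subst he; simp
      · simp [Function.update_of_ne he, Finsupp.single_eq_of_ne he]
  by_cases h : i = j
  · subst h
    simp only [key, true_and, if_true, MvPowerSeries.coeff_X_pow]
  · simp only [key, h, false_and, if_false, map_zero]

end Coord

/-! ### The model case Φ = t^q -/

section PowSubst

variable {R : Type*} [CommRing R] {D : Type*} [Finite D] [DecidableEq D]
  {S : Type*} [CommRing S] [Algebra R S]

theorem coeff_insertAt_X_pow {q : ℕ} (hq : 0 < q)
    (h : PowerSeries.constantCoeff (PowerSeries.X ^ q : R⟦X⟧) = 0) (d : D)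
    (x : MvPowerSeries D S) (n : D →₀ ℕ) :
    MvPowerSeries.coeff n (insertAt S (PowerSeries.X ^ q : R⟦X⟧) h d x) =
      if q ∣ n d then MvPowerSeries.coeff (n.update d (n d / q)) x else 0 := by
  have hprod : ∀ m : D →₀ ℕ, (m.prod fun s k => (Function.update MvPowerSeries.X d
        (PowerSeries.subst (MvPowerSeries.X d : MvPowerSeries D S)
          (PowerSeries.X ^ q : R⟦X⟧)) s) ^ k) =
      MvPowerSeries.monomial (m.update d (q * m d)) (1 : S) := by
    intro m
    cases nonempty_fintype D
    rw [MvPowerSeries.monomial_one_eq, Finsupp.prod_fintype _ _ (by simp),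
      Finsupp.prod_fintype _ _ (by simp)]
    refine Finset.prod_congr rfl fun s _ => ?_
    by_cases hs : s = d
    · subst hs
      rw [Function.update_self, PowerSeries.subst_pow (PowerSeries.HasSubst.X s),
        PowerSeries.subst_X (PowerSeries.HasSubst.X s), ← pow_mul]
      simp
    · simp [Function.update_of_ne hs]
  rw [insertAt_apply, MvPowerSeries.coeff_subst (hasSubst_insert S _ h d)]
  simp only [hprod, MvPowerSeries.coeff_monomial]
  by_cases hd : q ∣ n d
  · obtain ⟨k, hk⟩ := hd
    rw [if_pos ⟨k, hk⟩, finsum_eq_single _ (n.update d (n d / q)), if_pos, smul_eq_mul, mul_one]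
    · ext e
      by_cases he : e = d
      · subst he; simp [hk, Nat.mul_div_cancel_left k hq]
      · simp [Function.update_of_ne he]
    · intro m hm
      rw [if_neg, smul_zero]
      rintro rfl
      apply hm
      ext e
      by_cases he : e = d
      · subst he; simp [Nat.mul_div_cancel_left _ hq]
      · simp [Function.update_of_ne he]
  · rw [if_neg hd, finsum_eq_zero_of_forall_eq_zero]
    intro m
    rw [if_neg, smul_zero]
    rintro rfl
    exact hd (by simp)

theorem coord_insertAt_X_pow_mul {q : ℕ} (hq : 0 < q)
    (h : PowerSeries.constantCoeff (PowerSeries.X ^ q : R⟦X⟧) = 0) (d : D)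
    (x : MvPowerSeries D S) {i j : ℕ} (hi : i < q) (hj : j < q) :
    coord q d j (insertAt S (PowerSeries.X ^ q : R⟦X⟧) h d x * MvPowerSeries.X d ^ i) =
      if i = j then x else 0 := by
  ext n
  rw [coeff_coord, MvPowerSeries.X_pow_eq, MvPowerSeries.coeff_mul_monomial, mul_one,
    coeff_insertAt_X_pow hq]
  have hle : Finsupp.single d i ≤ n.update d (q * n d + j) ↔ i ≤ q * n d + j := by
    rw [Finsupp.single_le_iff]; simp
  simp only [hle]
  have hval : (n.update d (q * n d + j) - Finsupp.single d i) d = q * n d + j - i := by simp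
  rw [hval]
  by_cases hij : i = j
  · subst hij
    rw [if_pos (by omega), if_pos (by simp), if_pos rfl]
    congr 2
    ext e
    by_cases he : e = d
    · subst he; simp [Nat.mul_div_cancel_left _ hq]
    · simp [Function.update_of_ne he, Finsupp.single_eq_of_ne he]
  · rw [if_neg hij, map_zero]
    split_ifs with h1 h2
    · exfalso
      obtain ⟨k, hk⟩ := h2
      have h3 : q * n d + j = q * k + i := by omega
      have := congrArg (· % q) h3
      simp [Nat.mod_eq_of_lt hi, Nat.mod_eq_of_lt hj] at this
      exact hij this.symm
    · rfl
    · rfl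

end PowSubst

/-! ### The basis over the image of φ_d and divisibility of the trace -/

section PhiBasis

variable {R : Type*} [CommRing R] {π : R} (Φ : LubinTateSeries π)
  {D : Type*} [Finite D] [DecidableEq D] {S : Type*} [CommRing S] [Algebra R S] (d : D) (q : ℕ)

/-- The map `(v_i) ↦ ∑ φ_d (v_i) t_d ^ i`. -/
def phiSum : (Fin q → MvPowerSeries D S) →ₗ[S] MvPowerSeries D S :=
  ∑ i : Fin q, LinearMap.mulRight S (MvPowerSeries.X d ^ (i : ℕ)) ∘ₗ
    (phi S Φ d).toLinearMap ∘ₗ LinearMap.proj i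

theorem phiSum_apply (v : Fin q → MvPowerSeries D S) :
    phiSum Φ d q v = ∑ i : Fin q, phi S Φ d (v i) * MvPowerSeries.X d ^ (i : ℕ) := by
  simp [phiSum]

/-- The family of all coordinates `coord q d i` with `i < q`. -/
def coordVec {D S : Type*} [CommRing S] (q : ℕ) (d : D) :
    MvPowerSeries D S →ₗ[S] (Fin q → MvPowerSeries D S) :=
  LinearMap.pi fun i => coord q d i

theorem coordVec_apply {D S : Type*} [CommRing S] (q : ℕ) (d : D) (x : MvPowerSeries D S)
    (i : Fin q) : coordVec q d x i = coord q d i x :=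
  rfl

variable {q}

/-- Over S/(π) the series Φ becomes t^q, so the model case applies exactly there. -/
theorem coord_phi_mul (hq : q = Nat.card (R ⧸ Ideal.span {π})) (hq0 : 0 < q)
    (x : MvPowerSeries D S) {i j : ℕ} (hi : i < q) (hj : j < q) :
    ∃ w, coord q d j (phi S Φ d x * MvPowerSeries.X d ^ i) =
      (if i = j then x else 0) + algebraMap R S π • w := by
  have h0 : PowerSeries.constantCoeff (PowerSeries.X ^ q : R⟦X⟧) = 0 := by
    simp [hq0.ne']
  suffices h : MvPowerSeries.map (Ideal.Quotient.mk (Ideal.span {algebraMap R S π}))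
      (coord q d j (phi S Φ d x * MvPowerSeries.X d ^ i) - if i = j then x else 0) = 0 by
    obtain ⟨w, hw⟩ := (MvPowerSeries.ker_map_mk_span_singleton _ _).mp h
    exact ⟨w, by rw [← hw, add_sub_cancel]⟩
  rw [map_sub, map_coord, map_mul, map_pow, MvPowerSeries.map_X, phi,
    map_insertAt (S' := S ⧸ Ideal.span {algebraMap R S π}) _ (fun _ => rfl),
    insertAt_eq_of_forall_algebraMap (g := PowerSeries.X ^ q) Φ.constantCoeff_eq h0,
    coord_insertAt_X_pow_mul hq0 h0 d _ hi hj, apply_ite (MvPowerSeries.map _), map_zero, sub_self]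
  intro n
  rw [← sub_eq_zero, ← map_sub, ← map_sub, hq]
  change Ideal.Quotient.mk _ (algebraMap R S _) = 0
  rw [Ideal.Quotient.eq_zero_iff_mem, Ideal.mem_span_singleton]
  exact map_dvd _ (Φ.congr_pow n)

theorem coordVec_phiSum (hq : q = Nat.card (R ⧸ Ideal.span {π})) (hq0 : 0 < q)
    (v : Fin q → MvPowerSeries D S) :
    ∃ w, (coordVec q d ∘ₗ phiSum Φ d q) v = v + algebraMap R S π • w := by
  choose w hw using fun i j : Fin q => coord_phi_mul Φ d hq hq0 (v i) i.2 j.2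
  refine ⟨fun j => ∑ i, w i j, ?_⟩
  ext1 j
  rw [LinearMap.comp_apply, coordVec_apply, phiSum_apply, map_sum]
  simp only [hw, Finset.sum_add_distrib, Pi.add_apply, Pi.smul_apply, Finset.smul_sum]
  simp [Fin.val_inj]

theorem phiSum_bijective (hq : q = Nat.card (R ⧸ Ideal.span {π})) (hq0 : 0 < q)
    (hS : IsTorsionFreeComplete (algebraMap R S π) S) :
    Function.Bijective (phiSum (S := S) Φ d q) := by
  have h := ((hS.mvPowerSeries D).pi (Fin q)).bijective _ (coordVec_phiSum Φ d hq hq0)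
  rw [LinearMap.coe_comp] at h
  refine ⟨h.1.of_comp, fun x => ?_⟩
  obtain ⟨v, hv⟩ := h.2 (coordVec q d x)
  exact ⟨v, eq_of_forall_coord hq0 d fun i hi => congrFun hv ⟨i, hi⟩⟩

variable (hq : q = Nat.card (R ⧸ Ideal.span {π})) (hq0 : 0 < q)
  (hS : IsTorsionFreeComplete (algebraMap R S π) S)

/-- The bijection `(v_i) ↦ ∑ φ_d (v_i) t_d ^ i`. -/
def phiEquiv : (Fin q → MvPowerSeries D S) ≃ₗ[S] MvPowerSeries D S :=
  LinearEquiv.ofBijective (phiSum Φ d q) (phiSum_bijective Φ d hq hq0 hS)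

theorem phiEquiv_apply (v : Fin q → MvPowerSeries D S) :
    phiEquiv Φ d hq hq0 hS v = ∑ i : Fin q, phi S Φ d (v i) * MvPowerSeries.X d ^ (i : ℕ) :=
  phiSum_apply Φ d q v

theorem sum_phiEquiv_symm (x : MvPowerSeries D S) :
    ∑ i : Fin q, phi S Φ d ((phiEquiv Φ d hq hq0 hS).symm x i) * MvPowerSeries.X d ^ (i : ℕ) =
      x := by
  rw [← phiEquiv_apply Φ d hq hq0 hS, LinearEquiv.apply_symm_apply]

theorem phiEquiv_symm_sum (v : Fin q → MvPowerSeries D S) :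
    (phiEquiv Φ d hq hq0 hS).symm
      (∑ i : Fin q, phi S Φ d (v i) * MvPowerSeries.X d ^ (i : ℕ)) = v := by
  rw [← phiEquiv_apply Φ d hq hq0 hS, LinearEquiv.symm_apply_apply]

theorem phiEquiv_symm_phi_mul (b x : MvPowerSeries D S) (i : Fin q) :
    (phiEquiv Φ d hq hq0 hS).symm (phi S Φ d b * x) i =
      b * (phiEquiv Φ d hq hq0 hS).symm x i := by
  conv_lhs => rw [← sum_phiEquiv_symm Φ d hq hq0 hS x, Finset.mul_sum]
  simp only [← mul_assoc, ← map_mul]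
  exact congrFun (phiEquiv_symm_sum Φ d hq hq0 hS _) i

/-- Apply σ to the expansion of x and use uniqueness. No invertibility of σ enters, so this covers
φ_{d'} as well as γ_{d'}. -/
theorem phiEquiv_symm_comm (σ : MvPowerSeries D S →+* MvPowerSeries D S)
    (h : ∀ x, σ (phi S Φ d x) = phi S Φ d (σ x)) (hX : σ (MvPowerSeries.X d) = MvPowerSeries.X d)
    (x : MvPowerSeries D S) (i : Fin q) :
    (phiEquiv Φ d hq hq0 hS).symm (σ x) i = σ ((phiEquiv Φ d hq hq0 hS).symm x i) := by
  conv_lhs => rw [← sum_phiEquiv_symm Φ d hq hq0 hS x, map_sum]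
  simp only [map_mul, map_pow, h, hX]
  exact congrFun (phiEquiv_symm_sum Φ d hq hq0 hS fun i =>
    σ ((phiEquiv Φ d hq hq0 hS).symm x i)) i

include hq hq0 hS in
theorem phi_injective : Function.Injective (phi S Φ d) := by
  intro x y h
  have := congrArg (fun z => (phiEquiv Φ d hq hq0 hS).symm (z * 1) ⟨0, hq0⟩) h
  have h1 : (phiEquiv Φ d hq hq0 hS).symm 1 ⟨0, hq0⟩ = 1 := by
    have := congrFun (phiEquiv_symm_sum Φ d hq hq0 hS (Pi.single ⟨0, hq0⟩ 1)) ⟨0, hq0⟩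
    rw [Finset.sum_eq_single ⟨0, hq0⟩] at this
    · simpa using this
    · intro i _ hi
      simp [Pi.single_eq_of_ne hi]
    · simp
  simp only [phiEquiv_symm_phi_mul, h1] at this
  simpa using this

theorem phiEquiv_symm_congr (x : MvPowerSeries D S) (i : Fin q) :
    ∃ w, (phiEquiv Φ d hq hq0 hS).symm x i = coord q d i x + algebraMap R S π • w := by
  obtain ⟨w, hw⟩ := coordVec_phiSum Φ d hq hq0 ((phiEquiv Φ d hq hq0 hS).symm x)
  refine ⟨-w i, ?_⟩
  have := congrFun hw i
  rw [LinearMap.comp_apply, coordVec_apply, phiSum_apply, sum_phiEquiv_symm] at this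
  rw [this, Pi.add_apply, Pi.smul_apply, smul_neg, add_neg_cancel_right]

/-- The second-order version of `phiEquiv_symm_congr`, from G⁻¹ ≡ 2 - G modulo π². It is needed
because ψ_d involves a division by π. -/
theorem phiEquiv_symm_congr_sq (x : MvPowerSeries D S) (i : Fin q) :
    ∃ w, (phiEquiv Φ d hq hq0 hS).symm x i =
      (coord q d i x + coord q d i x - coord q d i (phiSum Φ d q (coordVec q d x))) +
        (algebraMap R S π * algebraMap R S π) • w := by
  have h : (coordVec q d ∘ₗ phiSum Φ d q) ((phiEquiv Φ d hq hq0 hS).symm x) = coordVec q d x := by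
    rw [LinearMap.comp_apply, phiSum_apply, sum_phiEquiv_symm]
  obtain ⟨w, hw⟩ := exists_eq_two_smul_sub _ (coordVec_phiSum Φ d hq hq0) h
  exact ⟨w i, congrFun hw i⟩

/-- The basis `1, t_d, …, t_d ^ (q - 1)` of the ring of power series over the image of `φ_d`. -/
def phiBasis : Module.Basis (Fin q) (phi S Φ d).range (MvPowerSeries D S) :=
  Module.Basis.mk (v := fun i : Fin q => MvPowerSeries.X d ^ (i : ℕ))
    (by
      rw [Fintype.linearIndependent_iff]
      intro g hg i
      choose v hv using fun i => (g i).2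
      have h0 := phiEquiv_symm_sum Φ d hq hq0 hS v
      have h1 : ∑ i : Fin q, phi S Φ d (v i) * MvPowerSeries.X d ^ (i : ℕ) = 0 := by
        rw [← hg]
        exact Finset.sum_congr rfl fun i _ => congrArg (· * MvPowerSeries.X d ^ (i : ℕ)) (hv i)
      rw [h1, map_zero] at h0
      refine Subtype.ext ?_
      rw [← hv i, ← h0]
      exact map_zero (phi S Φ d))
    (by
      intro x _
      rw [← sum_phiEquiv_symm Φ d hq hq0 hS x]
      exact Submodule.sum_mem _ fun i _ => Submodule.smul_mem _
        (⟨_, AlgHom.mem_range_self (phi S Φ d) _⟩ : (phi S Φ d).range)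
        (Submodule.subset_span ⟨i, rfl⟩))

theorem phiBasis_apply (i : Fin q) :
    phiBasis Φ d hq hq0 hS i = MvPowerSeries.X d ^ (i : ℕ) := by
  rw [phiBasis, Module.Basis.mk_apply]

theorem phiBasis_repr (x : MvPowerSeries D S) (i : Fin q) :
    ((phiBasis Φ d hq hq0 hS).repr x i : MvPowerSeries D S) =
      phi S Φ d ((phiEquiv Φ d hq hq0 hS).symm x i) := by
  have h : ∑ i : Fin q, (⟨_, AlgHom.mem_range_self (phi S Φ d)
      ((phiEquiv Φ d hq hq0 hS).symm x i)⟩ : (phi S Φ d).range) • phiBasis Φ d hq hq0 hS i =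
        x := by
    conv_rhs => rw [← sum_phiEquiv_symm Φ d hq hq0 hS x]
    refine Finset.sum_congr rfl fun i _ => ?_
    rw [phiBasis_apply]
    rfl
  conv_lhs => rw [← h, Module.Basis.repr_sum_self]

/-- The sum of the diagonal coordinates of multiplication by `x`, an `S`-linear map. -/
def diagSum : MvPowerSeries D S →ₗ[S] MvPowerSeries D S :=
  ∑ j : Fin q, LinearMap.proj j ∘ₗ (phiEquiv Φ d hq hq0 hS).symm.toLinearMap ∘ₗ
    LinearMap.mulRight S (MvPowerSeries.X d ^ (j : ℕ))

theorem diagSum_apply (x : MvPowerSeries D S) :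
    diagSum Φ d hq hq0 hS x =
      ∑ j : Fin q, (phiEquiv Φ d hq hq0 hS).symm (x * MvPowerSeries.X d ^ (j : ℕ)) j := by
  simp [diagSum]

theorem trace_eq_phi_diagSum (x : MvPowerSeries D S) :
    (Algebra.trace (phi S Φ d).range (MvPowerSeries D S) x : MvPowerSeries D S) =
      phi S Φ d (diagSum Φ d hq hq0 hS x) := by
  rw [Algebra.trace_eq_matrix_trace (phiBasis Φ d hq hq0 hS), Matrix.trace, diagSum_apply, map_sum,
    AddSubmonoidClass.coe_finsetSum]
  refine Finset.sum_congr rfl fun j _ => ?_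
  rw [Matrix.diag_apply, Algebra.leftMulMatrix_eq_repr_mul, phiBasis_repr, phiBasis_apply]

/-- Modulo π each of the q diagonal entries is `coord q d 0 x`, so the sum is q = πc times this
series. -/
theorem exists_diagSum_eq_smul {c : R} (hc : π * c = q) (x : MvPowerSeries D S) :
    ∃ y, diagSum Φ d hq hq0 hS x = algebraMap R S π • y := by
  choose w hw using fun j : Fin q =>
    phiEquiv_symm_congr Φ d hq hq0 hS (x * MvPowerSeries.X d ^ (j : ℕ)) j
  refine ⟨algebraMap R S c • coord q d 0 x + ∑ j, w j, ?_⟩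
  rw [diagSum_apply, Finset.sum_congr rfl fun j _ => hw j, Finset.sum_add_distrib, smul_add,
    Finset.smul_sum, smul_smul, ← map_mul, hc, map_natCast]
  simp [coord_mul_X_pow_self, Nat.cast_smul_eq_nsmul]

end PhiBasis

/-! ### The operator ψ_d and its equivariance -/

section TracePsi

variable {R : Type*} [CommRing R] {π : R} (Φ : LubinTateSeries π)
  {D : Type*} [Finite D] [DecidableEq D] {S : Type*} [CommRing S] [Algebra R S] (d : D) {q : ℕ}
  (hq : q = Nat.card (R ⧸ Ideal.span {π})) (hq0 : 0 < q)
  (hS : IsTorsionFreeComplete (algebraMap R S π) S) {c : R} (hc : π * c = q)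

/-- The operator `π⁻¹ φ_d⁻¹ ∘ trace`. -/
def tracePsi : MvPowerSeries D S →ₗ[S] MvPowerSeries D S where
  toFun x := (exists_diagSum_eq_smul Φ d hq hq0 hS hc x).choose
  map_add' x y := (hS.mvPowerSeries D).smul_left_cancel (by
    rw [smul_add, ← (exists_diagSum_eq_smul Φ d hq hq0 hS hc x).choose_spec,
      ← (exists_diagSum_eq_smul Φ d hq hq0 hS hc y).choose_spec,
      ← (exists_diagSum_eq_smul Φ d hq hq0 hS hc (x + y)).choose_spec, map_add])
  map_smul' s x := (hS.mvPowerSeries D).smul_left_cancel (by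
    rw [RingHom.id_apply, smul_comm,
      ← (exists_diagSum_eq_smul Φ d hq hq0 hS hc x).choose_spec,
      ← (exists_diagSum_eq_smul Φ d hq hq0 hS hc (s • x)).choose_spec, map_smul])

theorem smul_tracePsi (x : MvPowerSeries D S) :
    algebraMap R S π • tracePsi Φ d hq hq0 hS hc x = diagSum Φ d hq hq0 hS x :=
  (exists_diagSum_eq_smul Φ d hq hq0 hS hc x).choose_spec.symm

theorem trace_eq_C_mul_phi_tracePsi (x : MvPowerSeries D S) :
    (Algebra.trace (phi S Φ d).range (MvPowerSeries D S) x : MvPowerSeries D S) =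
      MvPowerSeries.C (algebraMap R S π) * phi S Φ d (tracePsi Φ d hq hq0 hS hc x) := by
  rw [trace_eq_phi_diagSum Φ d hq hq0 hS, ← smul_tracePsi Φ d hq hq0 hS hc, map_smul,
    MvPowerSeries.smul_eq_C_mul]

theorem tracePsi_phi_mul (b x : MvPowerSeries D S) :
    tracePsi Φ d hq hq0 hS hc (phi S Φ d b * x) = b * tracePsi Φ d hq hq0 hS hc x := by
  apply (hS.mvPowerSeries D).smul_left_cancel
  rw [smul_tracePsi, ← mul_smul_comm, smul_tracePsi, diagSum_apply, diagSum_apply, Finset.mul_sum]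
  simp only [mul_assoc, phiEquiv_symm_phi_mul]

theorem tracePsi_comm (σ : MvPowerSeries D S →ₐ[S] MvPowerSeries D S)
    (h : ∀ x, σ (phi S Φ d x) = phi S Φ d (σ x)) (hX : σ (MvPowerSeries.X d) = MvPowerSeries.X d)
    (x : MvPowerSeries D S) :
    tracePsi Φ d hq hq0 hS hc (σ x) = σ (tracePsi Φ d hq hq0 hS hc x) := by
  apply (hS.mvPowerSeries D).smul_left_cancel
  rw [smul_tracePsi, ← map_smul, smul_tracePsi, diagSum_apply, diagSum_apply, map_sum]
  refine Finset.sum_congr rfl fun j _ => ?_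
  have := phiEquiv_symm_comm Φ d hq hq0 hS σ.toRingHom h hX (x * MvPowerSeries.X d ^ (j : ℕ)) j
  simpa [hX] using this

/-- Meant for γ_d, which moves t_d and hence the basis. The trace does not depend on the basis, so
it is respected by any automorphism of the ring that preserves the subring. -/
theorem tracePsi_comm_equiv (σ τ : MvPowerSeries D S →ₐ[S] MvPowerSeries D S)
    (h : ∀ x, σ (phi S Φ d x) = phi S Φ d (σ x))
    (h₁ : ∀ x, σ (τ x) = x) (h₂ : ∀ x, τ (σ x) = x) (x : MvPowerSeries D S) :
    tracePsi Φ d hq hq0 hS hc (σ x) = σ (tracePsi Φ d hq hq0 hS hc x) := by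
  have hτ : ∀ x, τ (phi S Φ d x) = phi S Φ d (τ x) := fun x => by
    conv_lhs => rw [← h₁ x, ← h, h₂]
  let e₂ : MvPowerSeries D S ≃+* MvPowerSeries D S :=
    RingEquiv.ofRingHom σ.toRingHom τ.toRingHom (RingHom.ext h₁) (RingHom.ext h₂)
  have hσr : ∀ y ∈ (phi S Φ d).range, σ y ∈ (phi S Φ d).range := by
    rintro _ ⟨y, rfl⟩
    exact ⟨σ y, (h y).symm⟩
  have hτr : ∀ y ∈ (phi S Φ d).range, τ y ∈ (phi S Φ d).range := by
    rintro _ ⟨y, rfl⟩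
    exact ⟨τ y, (hτ y).symm⟩
  let e₁ : (phi S Φ d).range ≃+* (phi S Φ d).range :=
    { toFun := fun y => ⟨σ y, hσr _ y.2⟩
      invFun := fun y => ⟨τ y, hτr _ y.2⟩
      left_inv := fun y => Subtype.ext (h₂ _)
      right_inv := fun y => Subtype.ext (h₁ _)
      map_mul' := fun y z => Subtype.ext (map_mul σ _ _)
      map_add' := fun y z => Subtype.ext (map_add σ _ _) }
  have key := Algebra.trace_eq_of_equiv_equiv e₁ e₂ (RingHom.ext fun _ => rfl) x
  rw [RingEquiv.eq_symm_apply] at key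
  have key' := congrArg (fun y : (phi S Φ d).range => (y : MvPowerSeries D S)) key
  change σ (Algebra.trace (phi S Φ d).range (MvPowerSeries D S) x : MvPowerSeries D S) =
    (Algebra.trace (phi S Φ d).range (MvPowerSeries D S) (σ x) : MvPowerSeries D S) at key'
  rw [trace_eq_phi_diagSum Φ d hq hq0 hS, trace_eq_phi_diagSum Φ d hq hq0 hS, h] at key'
  apply (hS.mvPowerSeries D).smul_left_cancel
  rw [smul_tracePsi, ← map_smul, smul_tracePsi]
  exact (phi_injective Φ d hq hq0 hS key').symm

end TracePsi

/-! ### Values of ψ_d on powers of t_d -/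

section Values

variable {R : Type*} [CommRing R] {π : R} (Φ : LubinTateSeries π)
  {D : Type*} [Finite D] [DecidableEq D] {S : Type*} [CommRing S] [Algebra R S] (d : D) {q : ℕ}
  (hq : q = Nat.card (R ⧸ Ideal.span {π})) (hq0 : 0 < q)
  (hS : IsTorsionFreeComplete (algebraMap R S π) S) {c : R} (hc : π * c = q)

theorem phiSum_coordVec_X_pow (m r : ℕ) (hr : r < q) :
    phiSum Φ d q (coordVec q d (MvPowerSeries.X d ^ (q * m + r) : MvPowerSeries D S)) =
      PowerSeries.subst (MvPowerSeries.X d) Φ.toSeries ^ m * MvPowerSeries.X d ^ r := by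
  rw [phiSum_apply, Finset.sum_eq_single ⟨r, hr⟩]
  · rw [coordVec_apply, coord_X_pow q d m r r hr hr, if_pos rfl, map_pow, phi, insertAt_X_self]
  · intro i _ hi
    rw [coordVec_apply, coord_X_pow q d m r i hr i.2, if_neg, map_zero, zero_mul]
    rintro rfl
    exact hi rfl
  · simp

/-- The constant coefficient of `ψ_d (t_d ^ (q - 1))`. -/
theorem constantCoeff_tracePsi_X_pow (hq1 : 1 < q) :
    ∃ w : S, MvPowerSeries.constantCoeff
      (tracePsi Φ d hq hq0 hS hc (MvPowerSeries.X d ^ (q - 1) : MvPowerSeries D S)) =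
        1 + algebraMap R S π * w := by
  set a := algebraMap R S π with ha
  have hj : ∀ j : Fin q, ∃ w : S, MvPowerSeries.constantCoeff ((phiEquiv Φ d hq hq0 hS).symm
      (MvPowerSeries.X d ^ (q - 1) * MvPowerSeries.X d ^ (j : ℕ)) j) =
        (if j = ⟨0, hq0⟩ then a else 0) - a + a * a * w := by
    intro j
    obtain ⟨w, hw⟩ := phiEquiv_symm_congr_sq Φ d hq hq0 hS
      (MvPowerSeries.X d ^ (q - 1) * MvPowerSeries.X d ^ (j : ℕ)) j
    refine ⟨MvPowerSeries.constantCoeff w, ?_⟩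
    rw [hw, ← pow_add, map_add, MvPowerSeries.smul_eq_C_mul, map_mul,
      MvPowerSeries.constantCoeff_C]
    congr 1
    obtain ⟨j, hj⟩ := j
    rcases Nat.eq_zero_or_pos j with rfl | hj0
    · have h := coord_X_pow (S := S) q d 0 (q - 1) 0 (by omega) hq0
      have h' := phiSum_coordVec_X_pow (S := S) Φ d 0 (q - 1) (q := q) (by omega)
      rw [mul_zero, zero_add, if_neg (by omega)] at h
      rw [mul_zero, zero_add, pow_zero, one_mul] at h'
      simp [h, h']
    -- G sends t_d^q t_d^(j-1) to Φ(t_d) t_d^(j-1), whose coefficient at t_d^j is π; in 2 - G this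
    -- contributes -π.
    · have e : q - 1 + j = q * 1 + (j - 1) := by omega
      rw [if_neg (by simp; omega)]
      simp only [e]
      rw [phiSum_coordVec_X_pow Φ d 1 (j - 1) (by omega),
        coord_X_pow q d 1 (j - 1) j (by omega) hj, if_neg (by omega), pow_one, add_zero, map_sub,
        map_zero]
      congr 1
      rw [← MvPowerSeries.coeff_zero_eq_constantCoeff_apply, coeff_coord, MvPowerSeries.X_pow_eq]
      have e' : (0 : D →₀ ℕ).update d (q * (0 : D →₀ ℕ) d + j) =
          Finsupp.single d 1 + Finsupp.single d (j - 1) := by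
        rw [← Finsupp.single_add, show 1 + (j - 1) = j by omega]
        ext e
        by_cases he : e = d
        · subst he; simp
        · simp [Finsupp.single_eq_of_ne he]
      rw [e', MvPowerSeries.coeff_add_mul_monomial, coeff_subst_X, if_pos (by simp), mul_one,
        Finsupp.single_eq_same, Φ.coeff_one_eq]
  choose w hw using hj
  -- The entries sum to π - qπ modulo π²; since q = πc, the term -qπ is -π²c, which leaves -c here.
  refine ⟨∑ j, w j - algebraMap R S c, ?_⟩
  have h := congrArg MvPowerSeries.constantCoeff (smul_tracePsi Φ d hq hq0 hS hc
    (MvPowerSeries.X d ^ (q - 1) : MvPowerSeries D S))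
  rw [diagSum_apply, map_sum, Finset.sum_congr rfl fun j _ => hw j, MvPowerSeries.smul_eq_C_mul,
    map_mul, MvPowerSeries.constantCoeff_C, Finset.sum_add_distrib, Finset.sum_sub_distrib,
    Finset.sum_ite_eq' , if_pos (Finset.mem_univ _), Finset.sum_const, Finset.card_univ,
    Fintype.card_fin, ← Finset.mul_sum, nsmul_eq_mul, ← map_natCast (algebraMap R S), ← hc,
    map_mul] at h
  apply hS.smul_left_cancel
  rw [smul_eq_mul, smul_eq_mul, ha, h]
  ring

include hS in
theorem isUnit_one_add_mul (w : S) : IsUnit (1 + algebraMap R S π * w) := by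
  obtain ⟨x, hx⟩ := (hS.bijective (LinearMap.mulLeft S (1 + algebraMap R S π * w)) fun v =>
    ⟨w * v, by simp [add_mul, mul_assoc]⟩).2 1
  exact IsUnit.of_mul_eq_one x hx

/-- By ψ_d(φ_d(a)x) = aψ_d(x) the image is an ideal, and it contains the unit ψ_d(t_d^(q-1)). -/
theorem tracePsi_surjective (hq1 : 1 < q) :
    Function.Surjective (tracePsi Φ d hq hq0 hS hc : MvPowerSeries D S → MvPowerSeries D S) := by
  obtain ⟨w, hw⟩ := constantCoeff_tracePsi_X_pow Φ d hq hq0 hS hc hq1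
  have hu : IsUnit (tracePsi Φ d hq hq0 hS hc (MvPowerSeries.X d ^ (q - 1))) := by
    rw [MvPowerSeries.isUnit_iff_constantCoeff, hw]
    exact isUnit_one_add_mul hS w
  obtain ⟨v, hv⟩ := hu.exists_left_inv
  exact fun x => ⟨phi S Φ d (x * v) * MvPowerSeries.X d ^ (q - 1), by
    rw [tracePsi_phi_mul, mul_assoc, hv, mul_one]⟩

/-- The trace of 1 is the rank q = πc. -/
theorem tracePsi_one : tracePsi Φ d hq hq0 hS hc 1 = MvPowerSeries.C (algebraMap R S c) := by
  apply (hS.mvPowerSeries D).smul_left_cancel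
  have h : ∀ j : Fin q, (phiEquiv Φ d hq hq0 hS).symm (1 * MvPowerSeries.X d ^ (j : ℕ)) j = 1 := by
    intro j
    have := congrFun (phiEquiv_symm_sum Φ d hq hq0 hS (Pi.single j 1)) j
    rw [Finset.sum_eq_single j] at this
    · simpa using this
    · intro i _ hi
      simp [Pi.single_eq_of_ne hi]
    · simp
  rw [smul_tracePsi, diagSum_apply, Finset.sum_congr rfl fun j _ => h j,
    MvPowerSeries.smul_eq_C_mul, ← map_mul, ← map_mul, hc]
  simp

/-- The values of `ψ_d` modulo `π` for `Φ = π t + t ^ q`. -/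
theorem tracePsi_X_pow (hq1 : 1 < q)
    (hΦ : Φ.toSeries = PowerSeries.C π * PowerSeries.X + PowerSeries.X ^ q) (m i : ℕ)
    (hi : i < q) :
    ∃ w : MvPowerSeries D S, tracePsi Φ d hq hq0 hS hc (MvPowerSeries.X d ^ (q * m + i)) =
      (if i = q - 1 then MvPowerSeries.X d ^ m else if i = 0 then
        algebraMap R S c • MvPowerSeries.X d ^ m else 0) + algebraMap R S π • w := by
  set a := algebraMap R S π with ha
  set X : MvPowerSeries D S := MvPowerSeries.X d with hX
  have hP : PowerSeries.subst X Φ.toSeries = X ^ q + a • X := by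
    have hs := PowerSeries.HasSubst.X (S := S) d
    rw [hΦ, ← PowerSeries.smul_eq_C_mul, PowerSeries.subst_add hs, PowerSeries.subst_smul hs,
      PowerSeries.subst_pow hs, PowerSeries.subst_X hs, add_comm, ha, algebraMap_smul]
  -- Binomial expansion to first order in π. For k = 0 the truncated `k - 1` is harmless because its
  -- term has the factor k.
  have hPpow : ∀ k : ℕ, ∃ w, (X ^ q + a • X) ^ k =
      X ^ (q * k) + (k : S) • a • X ^ (q * (k - 1) + 1) + (a * a) • w := by
    intro k
    obtain ⟨w, hw⟩ := Polynomial.powAddExpansion (X ^ q) (a • X) k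
    refine ⟨w * X ^ 2, ?_⟩
    rw [hw]
    simp only [MvPowerSeries.smul_eq_C_mul, map_mul, map_natCast, ← pow_mul, pow_add, pow_one]
    ring
  -- With qm + i + j = qk + r, the correction in 2 - G is the linear binomial term kπ
  -- t_d^(q(k-1)+1+r). It meets coordinate j only if r + 1 ≡ j modulo q, that is i = q - 1. Then k =
  -- m for j = 0, and k = m + 1 for j > 0 because of the carry.
  have hj : ∀ j : Fin q, ∃ w, (phiEquiv Φ d hq hq0 hS).symm (X ^ (q * m + i) * X ^ (j : ℕ)) j =
      coord q d j (X ^ (q * m + i) * X ^ (j : ℕ)) -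
        (if i = q - 1 then
          (if j = ⟨0, hq0⟩ then (m : S) else (m + 1 : ℕ)) • a • X ^ m else 0) +
        (a * a) • w := by
    intro j
    obtain ⟨w, hw⟩ := phiEquiv_symm_congr_sq Φ d hq hq0 hS (X ^ (q * m + i) * X ^ (j : ℕ)) j
    obtain ⟨k, r, hr, hkr, hcase⟩ : ∃ k r, r < q ∧ q * m + i + j = q * k + r ∧
        (k = m ∧ r = i + j ∨ k = m + 1 ∧ r + q = i + j) := by
      by_cases h : i + j < q
      · exact ⟨m, i + j, h, by ring, Or.inl ⟨rfl, rfl⟩⟩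
      · refine ⟨m + 1, i + j - q, by omega, ?_, Or.inr ⟨rfl, by omega⟩⟩
        rw [mul_add]; omega
    obtain ⟨w', hw'⟩ := hPpow k
    rw [← pow_add, hkr] at hw ⊢
    rw [phiSum_coordVec_X_pow Φ d k r hr, hP, hw'] at hw
    refine ⟨w - coord q d j (w' * X ^ r), ?_⟩
    rw [hw]
    have hlin : coord q d j ((X ^ (q * k) + (k : S) • a • X ^ (q * (k - 1) + 1) + (a * a) • w') *
        X ^ r) = coord q d j (X ^ (q * k + r)) +
          (k : S) • a • coord q d j (X ^ (q * (k - 1) + 1 + r)) +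
          (a * a) • coord q d j (w' * X ^ r) := by
      simp only [add_mul, smul_mul_assoc, ← pow_add, map_add, map_smul]
    have hmid : (k : S) • a • coord q d j (X ^ (q * (k - 1) + 1 + r)) = (if i = q - 1 then
          (if j = ⟨0, hq0⟩ then (m : S) else (m + 1 : ℕ)) • a • X ^ m else 0) := by
      rcases Nat.eq_zero_or_pos k with hk0 | hk0
      · subst hk0
        have hm : m = 0 := by omega
        subst hm
        rw [Nat.cast_zero, zero_smul]
        split_ifs with h1 h2
        · simp
        · exfalso
          apply h2
          ext
          simp only
          omega
        · rfl
      obtain ⟨l, rfl⟩ : ∃ l, k = l + 1 := ⟨k - 1, by omega⟩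
      rw [Nat.add_sub_cancel]
      by_cases h1 : r + 1 < q
      · rw [add_assoc, coord_X_pow q d l (1 + r) j (by omega) j.2]
        by_cases h2 : i = q - 1
        · have hjr : 1 + r = j := by omega
          have hlm : l = m := by omega
          have hj0 : j ≠ ⟨0, hq0⟩ := by
            rintro rfl
            simp at hjr
          rw [if_pos hjr, if_pos h2, if_neg hj0, hlm]
        · rw [if_neg h2, if_neg (by omega), smul_zero, smul_zero]
      -- Here r = q - 1, so the exponent carries to q(l + 1) and lands in coordinate 0.
      · have e : q * l + 1 + r = q * (l + 1) + 0 := by rw [mul_add]; omega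
        rw [e, coord_X_pow q d (l + 1) 0 j hq0 j.2]
        by_cases h2 : i = q - 1
        · have hj0 : j = ⟨0, hq0⟩ := by
            ext
            simp only
            omega
          have hlm : l + 1 = m := by
            subst hj0
            simp at hcase
            omega
          rw [if_pos h2, if_pos (by simp [hj0]), if_pos hj0, hlm]
        · rw [if_neg h2, if_neg (by omega), smul_zero, smul_zero]
    rw [hlin, hmid, smul_sub]
    abel
  choose w hw using hj
  -- For i = q - 1 the corrections sum to (q(m+1) - 1)π t_d^m. The -1 produces the main term t_d^m,
  -- while q = πc turns the rest into this multiple of π.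
  refine ⟨∑ j, w j - (if i = q - 1 then
    algebraMap R S c • ((m + 1 : ℕ) : S) • X ^ m else 0), ?_⟩
  apply (hS.mvPowerSeries D).smul_left_cancel
  rw [smul_tracePsi, diagSum_apply, Finset.sum_congr rfl fun j _ => hw j, Finset.sum_add_distrib,
    Finset.sum_sub_distrib]
  have hself : ∀ j : Fin q, coord q d j (X ^ (q * m + i) * X ^ (j : ℕ)) =
      coord q d 0 (X ^ (q * m + i)) := fun j => coord_mul_X_pow_self q d j _
  simp only [hself]
  have hqa : (q : S) = a * algebraMap R S c := by rw [ha, ← map_mul, hc, map_natCast]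
  rw [coord_X_pow q d m i 0 hi hq0, Finset.sum_const, Finset.card_univ, Fintype.card_fin,
    ← Nat.cast_smul_eq_nsmul S, hqa, ← Finset.smul_sum]
  by_cases h1 : i = q - 1
  · have hsum : ∑ j : Fin q, (if j = ⟨0, hq0⟩ then (m : S) else (m + 1 : ℕ)) • a • X ^ m =
        (a * algebraMap R S c * (m + 1 : ℕ) - 1) • a • X ^ m := by
      rw [← Finset.sum_smul]
      congr 1
      have : ∀ j : Fin q, (if j = ⟨0, hq0⟩ then (m : S) else (m + 1 : ℕ)) =
          (m + 1 : ℕ) - if j = ⟨0, hq0⟩ then 1 else 0 := by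
        intro j
        split_ifs <;> simp
      rw [Finset.sum_congr rfl fun j _ => this j, Finset.sum_sub_distrib, Finset.sum_const,
        Finset.card_univ, Fintype.card_fin, nsmul_eq_mul, hqa, Finset.sum_ite_eq',
        if_pos (Finset.mem_univ _)]
    simp only [if_pos h1]
    rw [hsum, if_neg (by omega)]
    simp only [MvPowerSeries.smul_eq_C_mul, map_mul, map_natCast, map_sub, map_one]
    ring
  · simp only [if_neg h1, Finset.sum_const_zero, sub_zero]
    split_ifs
    · simp only [MvPowerSeries.smul_eq_C_mul, map_mul]
      ring
    · simp only [MvPowerSeries.smul_eq_C_mul, map_mul]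
      ring

end Values

/-! ### Existence of the series [γ]_Φ -/

section LubinTateExistence

open PowerSeries (X C coeff constantCoeff subst HasSubst)

theorem FiniteField.powerSeries_pow_card {k : Type*} [Field k] [Finite k] (g : k⟦X⟧) :
    g ^ Nat.card k = subst (X ^ Nat.card k : k⟦X⟧) g := by
  cases nonempty_fintype k
  obtain ⟨p, hchar, n, hp, hn⟩ := FiniteField.card' k
  have : Fact p.Prime := ⟨hp⟩
  have hfrob : iterateFrobenius k p n = RingHom.id k := by
    ext x
    rw [iterateFrobenius_def, ← hn, FiniteField.pow_card, RingHom.id_apply]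
  have h := MvPowerSeries.map_iterateFrobenius_expand p hp.ne_zero g n
  rw [hfrob, MvPowerSeries.map_id] at h
  rw [Nat.card_eq_fintype_card, hn]
  exact h.symm.trans (PowerSeries.expand_apply _ (pow_ne_zero _ hp.ne_zero) g)

variable {R : Type*} [CommRing R]

/-- Write u = u(0) + Xv. Then u(g) - u(f) = (g - f) v(g) + f (v(g) - v(f)), and the factor f gains
one power of X at each induction step. -/
theorem X_pow_dvd_subst_sub_subst {n : ℕ} {f g : R⟦X⟧} (hf : constantCoeff f = 0)
    (hg : constantCoeff g = 0) (h : X ^ n ∣ g - f) (u : R⟦X⟧) :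
    X ^ n ∣ subst g u - subst f u := by
  have hf' := HasSubst.of_constantCoeff_zero' hf
  have hg' := HasSubst.of_constantCoeff_zero' hg
  have key : ∀ k ≤ n, ∀ u : R⟦X⟧, X ^ k ∣ subst g u - subst f u := by
    intro k
    induction k with
    | zero => simp
    | succ k ih =>
      intro hk u
      obtain ⟨v, hv⟩ : X ∣ u - C (constantCoeff u) := by
        rw [PowerSeries.X_dvd_iff]; simp
      have hu : u = C (constantCoeff u) + X * v := by rw [← hv]; ring
      have hsub : ∀ a : R⟦X⟧, HasSubst a →
          subst a u = C (constantCoeff u) + a * subst a v := by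
        intro a ha
        conv_lhs => rw [hu]
        rw [PowerSeries.subst_add ha, PowerSeries.subst_mul ha, PowerSeries.subst_X ha,
          PowerSeries.subst_C]
        rfl
      have e : subst g u - subst f u =
          (g - f) * subst g v + f * (subst g v - subst f v) := by
        rw [hsub g hg', hsub f hf']; ring
      rw [e]
      refine dvd_add (((pow_dvd_pow _ hk).trans h).mul_right _) ?_
      rw [pow_succ']
      exact mul_dvd_mul (PowerSeries.X_dvd_iff.mpr hf) (ih (by omega) v)
  exact key n le_rfl u

/-- Beyond its linear term Φ is divisible by X^2, and g² - f² = (g - f)(g + f) gains a factor X. -/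
theorem subst_sub_subst_left {Φ : R⟦X⟧} (hΦ : constantCoeff Φ = 0) {n : ℕ} {f g : R⟦X⟧}
    (hf : constantCoeff f = 0) (hg : constantCoeff g = 0) (h : X ^ n ∣ g - f) :
    X ^ (n + 1) ∣ subst g Φ - subst f Φ - C (coeff 1 Φ) * (g - f) := by
  have hf' := HasSubst.of_constantCoeff_zero' hf
  have hg' := HasSubst.of_constantCoeff_zero' hg
  obtain ⟨v, hv⟩ : X ^ 2 ∣ Φ - C (coeff 1 Φ) * X := by
    rw [PowerSeries.X_pow_dvd_iff]
    intro m hm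
    interval_cases m
    · simp [hΦ]
    · simp
  have hsub : ∀ a : R⟦X⟧, HasSubst a →
      subst a Φ = C (coeff 1 Φ) * a + a ^ 2 * subst a v := by
    intro a ha
    have : Φ = C (coeff 1 Φ) * X + X ^ 2 * v := by rw [← hv]; ring
    conv_lhs => rw [this]
    rw [PowerSeries.subst_add ha, PowerSeries.subst_mul ha, PowerSeries.subst_mul ha,
      PowerSeries.subst_pow ha, PowerSeries.subst_X ha, PowerSeries.subst_C]
    rfl
  have e : subst g Φ - subst f Φ - C (coeff 1 Φ) * (g - f) =
      (g - f) * ((g + f) * subst g v) + (subst g v - subst f v) * f ^ 2 := by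
    rw [hsub g hg', hsub f hf']; ring
  have hfX : X ∣ f := PowerSeries.X_dvd_iff.mpr hf
  have hgX : X ∣ g := PowerSeries.X_dvd_iff.mpr hg
  rw [e, pow_succ]
  exact dvd_add (mul_dvd_mul h ((dvd_add hgX hfX).mul_right _))
    (mul_dvd_mul (X_pow_dvd_subst_sub_subst hf hg h v) (hfX.trans (dvd_pow_self f two_ne_zero)))

theorem subst_C_mul_X_pow {Φ : R⟦X⟧} (hΦ : constantCoeff Φ = 0) (n : ℕ) (a : R) :
    X ^ (n + 1) ∣ subst Φ (C a * X ^ n : R⟦X⟧) - C (a * coeff 1 Φ ^ n) * X ^ n := by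
  have hΦ' := HasSubst.of_constantCoeff_zero' hΦ
  obtain ⟨v, rfl⟩ := PowerSeries.X_dvd_iff.mpr hΦ
  have h1 : coeff 1 (X * v) = constantCoeff v := by
    rw [show (1 : ℕ) = 0 + 1 from rfl, PowerSeries.coeff_succ_X_mul,
      PowerSeries.coeff_zero_eq_constantCoeff]
  have e : subst (X * v) (C a * X ^ n : R⟦X⟧) = C a * (X * v) ^ n := by
    rw [PowerSeries.subst_mul hΦ', PowerSeries.subst_pow hΦ', PowerSeries.subst_X hΦ',
      PowerSeries.subst_C]
    rfl
  have e2 : C a * (X * v) ^ n - C (a * constantCoeff v ^ n) * X ^ n =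
      X ^ n * ((v ^ n - C (constantCoeff v) ^ n) * C a) := by
    rw [map_mul, map_pow]; ring
  rw [e, h1, e2, pow_succ]
  refine mul_dvd_mul_left _ (Dvd.dvd.mul_right ?_ _)
  rw [PowerSeries.X_dvd_iff]
  simp

variable {π : R} (Φ : LubinTateSeries π)

/-- Modulo π the claim is f^q = f(t^q), which is `hfrob`. -/
theorem dvd_coeff_subst_sub_subst
    (hfrob : ∀ g : (R ⧸ Ideal.span {π})⟦X⟧, g ^ Nat.card (R ⧸ Ideal.span {π}) =
      subst (X ^ Nat.card (R ⧸ Ideal.span {π}) : (R ⧸ Ideal.span {π})⟦X⟧) g)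
    {f : R⟦X⟧} (hf : constantCoeff f = 0) (n : ℕ) :
    π ∣ coeff n (subst f Φ.toSeries - subst Φ.toSeries f) := by
  have hf' := HasSubst.of_constantCoeff_zero' hf
  have hΦ' := HasSubst.of_constantCoeff_zero' Φ.constantCoeff_eq
  have hmapΦ : PowerSeries.map (Ideal.Quotient.mk (Ideal.span {π})) Φ.toSeries =
      X ^ Nat.card (R ⧸ Ideal.span {π}) := by
    rw [← PowerSeries.map_X (Ideal.Quotient.mk (Ideal.span {π})), ← map_pow, ← sub_eq_zero,
      ← map_sub]
    ext m
    rw [PowerSeries.coeff_map, map_zero, Ideal.Quotient.eq_zero_iff_mem,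
      Ideal.mem_span_singleton]
    exact Φ.congr_pow m
  have hmapf : HasSubst (PowerSeries.map (Ideal.Quotient.mk (Ideal.span {π})) f) :=
    HasSubst.of_constantCoeff_zero' (by
      rw [← PowerSeries.coeff_zero_eq_constantCoeff_apply, PowerSeries.coeff_map,
        PowerSeries.coeff_zero_eq_constantCoeff_apply, hf, map_zero])
  have h1 : PowerSeries.map (Ideal.Quotient.mk (Ideal.span {π})) (subst f Φ.toSeries) =
      subst (PowerSeries.map (Ideal.Quotient.mk (Ideal.span {π})) f)
        (PowerSeries.map (Ideal.Quotient.mk (Ideal.span {π})) Φ.toSeries) :=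
    PowerSeries.map_subst hf' _
  have h2 : PowerSeries.map (Ideal.Quotient.mk (Ideal.span {π})) (subst Φ.toSeries f) =
      subst (PowerSeries.map (Ideal.Quotient.mk (Ideal.span {π})) Φ.toSeries)
        (PowerSeries.map (Ideal.Quotient.mk (Ideal.span {π})) f) :=
    PowerSeries.map_subst hΦ' _
  rw [← Ideal.mem_span_singleton, ← Ideal.Quotient.eq_zero_iff_mem, ← PowerSeries.coeff_map,
    map_sub, h1, h2, hmapΦ, PowerSeries.subst_pow hmapf, PowerSeries.subst_X hmapf, hfrob, sub_self,
    map_zero]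

/-- Successive approximation: adding a t^n changes the error Φ∘f - f∘Φ by (π - π^n) a t^n to leading
order. The error is divisible by π and 1 - π^(n-1) is a unit for n ≥ 2, so it can be cancelled
degree by degree. Without existence `endoSeries` would be its default value 0. -/
theorem exists_isEndoSeries (hu : ∀ n : ℕ, 0 < n → IsUnit (1 - π ^ n))
    (hfrob : ∀ g : (R ⧸ Ideal.span {π})⟦X⟧, g ^ Nat.card (R ⧸ Ideal.span {π}) =
      subst (X ^ Nat.card (R ⧸ Ideal.span {π}) : (R ⧸ Ideal.span {π})⟦X⟧) g) (γ : R) :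
    ∃ f, IsEndoSeries Φ.toSeries γ f := by
  have hΦ := Φ.constantCoeff_eq
  have hΦ' := HasSubst.of_constantCoeff_zero' hΦ
  let E : R⟦X⟧ → R⟦X⟧ := fun f => subst f Φ.toSeries - subst Φ.toSeries f
  have hE : ∀ (n : ℕ) (f : R⟦X⟧) (a : R), 0 < n → constantCoeff f = 0 →
      X ^ (n + 1) ∣ E (f + C a * X ^ n) - E f - C (π * a - a * π ^ n) * X ^ n := by
    intro n f a hn hf
    have hg : constantCoeff (f + C a * X ^ n) = 0 := by simp [hf, hn.ne']
    have h1 := subst_sub_subst_left hΦ hf hg (n := n) (by rw [add_sub_cancel_left]; simp)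
    have h2 := subst_C_mul_X_pow hΦ n a
    have h3 := dvd_sub h1 h2
    rw [Φ.coeff_one_eq] at h3
    convert h3 using 1
    simp only [E]
    rw [PowerSeries.subst_add hΦ', map_sub, map_mul, add_sub_cancel_left]
    ring
  -- The hypotheses stand inside the existential so that `choose` yields a total function for the
  -- recursion.
  have step : ∀ (n : ℕ) (f : R⟦X⟧), ∃ a : R, 0 < n → constantCoeff f = 0 → X ^ (n + 1) ∣ E f →
      X ^ (n + 2) ∣ E (f + C a * X ^ (n + 1)) := by
    intro n f
    by_cases h : 0 < n ∧ constantCoeff f = 0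
    swap
    · exact ⟨0, fun h1 h2 => absurd ⟨h1, h2⟩ h⟩
    obtain ⟨b, hb⟩ := dvd_coeff_subst_sub_subst Φ hfrob h.2 (n + 1)
    obtain ⟨u, hu⟩ := (hu n h.1).exists_right_inv
    refine ⟨-(b * u), fun _ _ hdvd => ?_⟩
    have h1 := hE (n + 1) f (-(b * u)) (by omega) h.2
    have h2 : X ^ (n + 2) ∣ E f - C (π * b) * X ^ (n + 1) := by
      obtain ⟨v, hv⟩ := hdvd
      have hvb : constantCoeff v = π * b := by
        rw [← hb]
        change _ = coeff (n + 1) (E f)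
        rw [hv, PowerSeries.coeff_X_pow_mul', if_pos le_rfl, Nat.sub_self,
          PowerSeries.coeff_zero_eq_constantCoeff]
      have e : X ^ (n + 1) * v - C (π * b) * X ^ (n + 1) = X ^ (n + 1) * (v - C (π * b)) := by ring
      rw [hv, e, pow_succ]
      refine mul_dvd_mul_left _ ?_
      rw [PowerSeries.X_dvd_iff]
      simp [hvb]
    have h3 := dvd_add h1 h2
    convert h3 using 1
    have e : π * -(b * u) - -(b * u) * π ^ (n + 1) = -(π * b) := by
      linear_combination (-(π * b)) * hu
    rw [e, map_neg C (π * b)]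
    ring
  choose a ha using step
  let f : ℕ → R⟦X⟧ := fun n => Nat.rec (C γ * X) (fun n g => g + C (a (n + 1) g) * X ^ (n + 2)) n
  have hfs : ∀ n, f (n + 1) = f n + C (a (n + 1) (f n)) * X ^ (n + 2) := fun n => rfl
  have hf0 : ∀ n, constantCoeff (f n) = 0 := by
    intro n
    induction n with
    | zero => simp [f]
    | succ n ih => rw [hfs]; simp [ih]
  have hfE : ∀ n, X ^ (n + 2) ∣ E (f n) := by
    intro n
    induction n with
    | zero =>
      have h1 := hE 1 0 γ one_pos (map_zero _)
      have h2 : E 0 = 0 := by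
        simp only [E]
        rw [PowerSeries.subst_zero_of_constantCoeff_zero hΦ, ← PowerSeries.coe_substAlgHom hΦ',
          map_zero, sub_zero]
      rw [h2, pow_one, zero_add, sub_zero, pow_one, mul_comm γ, sub_self, map_zero, zero_mul,
        sub_zero] at h1
      exact h1
    | succ n ih => exact ha (n + 1) (f n) (by omega) (hf0 n) ih
  have hdiff : ∀ n k, X ^ (n + 2) ∣ f (n + k) - f n := by
    intro n k
    induction k with
    | zero => simp
    | succ k ih =>
      rw [← add_assoc, hfs, add_sub_right_comm]
      exact dvd_add ih ((pow_dvd_pow X (by omega)).mul_left _)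
  -- Later corrections to `f n` start in degree n + 2, so its n-th coefficient is final.
  let g : R⟦X⟧ := PowerSeries.mk fun n => coeff n (f n)
  have hg : ∀ n, X ^ (n + 2) ∣ g - f n := by
    intro n
    rw [PowerSeries.X_pow_dvd_iff]
    intro m hm
    rw [map_sub, PowerSeries.coeff_mk]
    rcases le_total m n with h | h
    · have := PowerSeries.X_pow_dvd_iff.mp (hdiff m (n - m)) m (by omega)
      rw [Nat.add_sub_cancel' h, map_sub] at this
      rw [sub_eq_zero] at this ⊢
      exact this.symm
    · have := PowerSeries.X_pow_dvd_iff.mp (hdiff n (m - n)) m (by omega)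
      rwa [Nat.add_sub_cancel' h, map_sub] at this
  have hg0 : constantCoeff g = 0 := by
    rw [← PowerSeries.coeff_zero_eq_constantCoeff_apply, PowerSeries.coeff_mk,
      PowerSeries.coeff_zero_eq_constantCoeff_apply, hf0]
  refine ⟨g, hg0, ?_, ?_⟩
  · have := PowerSeries.X_pow_dvd_iff.mp (hg 0) 1 (by omega)
    rw [map_sub, sub_eq_zero] at this
    rw [this]
    simp [f]
  · rw [← sub_eq_zero]
    ext n
    rw [map_zero]
    suffices h : X ^ (n + 2) ∣ subst g Φ.toSeries - subst Φ.toSeries g from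
      PowerSeries.X_pow_dvd_iff.mp h n (by omega)
    have h1 := X_pow_dvd_subst_sub_subst (hf0 n) hg0 (hg n) Φ.toSeries
    have h2 : X ^ (n + 2) ∣ subst Φ.toSeries g - subst Φ.toSeries (f n) := by
      rw [← PowerSeries.subst_sub hΦ']
      obtain ⟨v, hv⟩ := hg n
      rw [hv, PowerSeries.subst_mul hΦ', PowerSeries.subst_pow hΦ', PowerSeries.subst_X hΦ']
      exact (pow_dvd_pow_of_dvd (PowerSeries.X_dvd_iff.mpr hΦ) _).mul_right _
    have h3 := dvd_add (dvd_sub h1 h2) (hfE n)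
    convert h3 using 1
    simp only [E]
    ring

end LubinTateExistence

/-! ### Descent of linear operators to S/I -/

section Descent

variable {D S : Type*} [CommRing S] (I : Ideal S)

theorem map_mk_surjective :
    Function.Surjective (MvPowerSeries.map (σ := D) (Ideal.Quotient.mk I)) := fun x => by
  choose y hy using fun n => Ideal.Quotient.mk_surjective (MvPowerSeries.coeff n x)
  exact ⟨y, MvPowerSeries.ext hy⟩

/-- As I is finitely generated, a series with coefficients in I is a finite combination ∑ g_i y_i of
the generators. Linearity of T suffices, with no continuity. -/
theorem map_mk_linear_eq_zero (hI : I.FG) (T : MvPowerSeries D S →ₗ[S] MvPowerSeries D S)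
    {x : MvPowerSeries D S} (hx : MvPowerSeries.map (Ideal.Quotient.mk I) x = 0) :
    MvPowerSeries.map (Ideal.Quotient.mk I) (T x) = 0 := by
  obtain ⟨n, g, rfl⟩ := Submodule.fg_iff_exists_fin_generating_family.mp hI
  have h : ∀ m, ∃ c : Fin n → S, ∑ i, c i • g i = MvPowerSeries.coeff m x := fun m => by
    rw [← Submodule.mem_span_range_iff_exists_fun]
    have := congrArg (MvPowerSeries.coeff m) hx
    rwa [MvPowerSeries.coeff_map, map_zero, Ideal.Quotient.eq_zero_iff_mem] at this
  choose c hc using h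
  let y : Fin n → MvPowerSeries D S := fun i m => c m i
  have hxy : x = ∑ i, g i • y i := by
    ext m
    rw [← hc, map_sum]
    exact Finset.sum_congr rfl fun i _ => mul_comm _ _
  rw [hxy, map_sum, map_sum]
  refine Finset.sum_eq_zero fun i _ => ?_
  have hgi : g i ∈ Submodule.span S (Set.range g) := Submodule.subset_span ⟨i, rfl⟩
  rw [map_smul, MvPowerSeries.smul_eq_C_mul, map_mul, MvPowerSeries.map_C,
    Ideal.Quotient.eq_zero_iff_mem.mpr hgi, map_zero, zero_mul]

/-- The map on power series over `S / I` induced by an `S`-linear map on power series over `S`. -/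
def quotMap (hI : I.FG) (T : MvPowerSeries D S →ₗ[S] MvPowerSeries D S) :
    MvPowerSeries D (S ⧸ I) →+ MvPowerSeries D (S ⧸ I) :=
  AddMonoidHom.liftOfRightInverse (MvPowerSeries.map (Ideal.Quotient.mk I)).toAddMonoidHom
    (Function.surjInv (map_mk_surjective I)) (Function.surjInv_eq (map_mk_surjective I))
    ⟨(MvPowerSeries.map (Ideal.Quotient.mk I)).toAddMonoidHom.comp T.toAddMonoidHom, fun _ hx =>
      map_mk_linear_eq_zero I hI T hx⟩

theorem quotMap_map (hI : I.FG) (T : MvPowerSeries D S →ₗ[S] MvPowerSeries D S)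
    (x : MvPowerSeries D S) :
    quotMap I hI T (MvPowerSeries.map (Ideal.Quotient.mk I) x) =
      MvPowerSeries.map (Ideal.Quotient.mk I) (T x) :=
  AddMonoidHom.liftOfRightInverse_comp_apply _ _ _ _ x

theorem quotMap_surjective (hI : I.FG) {T : MvPowerSeries D S →ₗ[S] MvPowerSeries D S}
    (hT : Function.Surjective T) : Function.Surjective (quotMap I hI T) := fun x => by
  obtain ⟨y, rfl⟩ := map_mk_surjective I x
  obtain ⟨z, rfl⟩ := hT y
  exact ⟨_, quotMap_map I hI T z⟩

end Descent

/-! ### The ψ-operator axioms -/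

section PsiOperator

variable {R : Type*} [CommRing R] {π : R} (Φ : LubinTateSeries π)
  {D : Type*} [Finite D] [DecidableEq D] {S : Type*} [CommRing S] [Algebra R S]

theorem map_mk_insertAt (I : Ideal S) (f : R⟦X⟧) (hf : PowerSeries.constantCoeff f = 0) (d : D)
    (x : MvPowerSeries D S) :
    MvPowerSeries.map (Ideal.Quotient.mk I) (insertAt S f hf d x) =
      insertAt (S ⧸ I) f hf d (MvPowerSeries.map (Ideal.Quotient.mk I) x) :=
  have h : ∀ r, Ideal.Quotient.mk I (algebraMap R S r) = algebraMap R (S ⧸ I) r := fun _ => rfl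
  map_insertAt (R := R) (Ideal.Quotient.mk I) h f hf d x

theorem isPsiOperator_quotMap (I : Ideal S) (hI : I.FG)
    (T : D → MvPowerSeries D S →ₗ[S] MvPowerSeries D S)
    (hT : IsPsiOperator Φ fun d => (T d).toAddMonoidHom) :
    IsPsiOperator Φ fun d => quotMap I hI (T d) where
  comm_gamma γ d d' x := by
    obtain ⟨y, rfl⟩ := map_mk_surjective I x
    simp only [gammaAct, ← map_mk_insertAt, quotMap_map]
    exact congrArg _ (hT.comm_gamma γ d d' y)
  comm_var d d' h x := by
    obtain ⟨y, rfl⟩ := map_mk_surjective I x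
    rw [← MvPowerSeries.map_X (Ideal.Quotient.mk I), ← map_mul, quotMap_map, quotMap_map, ← map_mul]
    exact congrArg _ (hT.comm_var d d' h y)
  comm_phi d d' h x := by
    obtain ⟨y, rfl⟩ := map_mk_surjective I x
    simp only [phi, ← map_mk_insertAt, quotMap_map]
    exact congrArg _ (hT.comm_phi d d' h y)
  phi_mul d b x := by
    obtain ⟨y, rfl⟩ := map_mk_surjective I x
    obtain ⟨b, rfl⟩ := map_mk_surjective I b
    simp only [phi, ← map_mk_insertAt, ← map_mul, quotMap_map]
    exact congrArg _ (hT.phi_mul d b y)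

theorem IsPsiOperator.smul {T : D → MvPowerSeries D S →ₗ[S] MvPowerSeries D S}
    (hT : IsPsiOperator Φ fun d => (T d).toAddMonoidHom) (s : S) :
    IsPsiOperator Φ fun d => (s • T d).toAddMonoidHom where
  comm_gamma γ d d' x := by
    have := congrArg (s • ·) (hT.comm_gamma γ d d' x)
    exact this.trans (map_smul (gammaAct S Φ γ d') s _).symm
  comm_var d d' h x := by
    have := congrArg (s • ·) (hT.comm_var d d' h x)
    exact this.trans (mul_smul_comm _ _ _).symm
  comm_phi d d' h x := by
    have := congrArg (s • ·) (hT.comm_phi d d' h x)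
    exact this.trans (map_smul (phi S Φ d') s _).symm
  phi_mul d b x := by
    have := congrArg (s • ·) (hT.phi_mul d b x)
    exact this.trans (mul_smul_comm _ _ _).symm

theorem endoSeries_spec {Φ : R⟦X⟧} {γ : R} (h : ∃ f, IsEndoSeries Φ γ f) :
    IsEndoSeries Φ γ (endoSeries Φ γ) := by
  rw [endoSeries, dif_pos h]
  exact h.choose_spec

theorem isPsiOperator_tracePsi {q : ℕ} (hq : q = Nat.card (R ⧸ Ideal.span {π})) (hq0 : 0 < q)
    (hS : IsTorsionFreeComplete (algebraMap R S π) S) {c : R} (hc : π * c = q)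
    (hex : ∀ γ : R, ∃ f, IsEndoSeries Φ.toSeries γ f) :
    IsPsiOperator Φ fun d : D =>
      (tracePsi Φ d hq hq0 hS hc : MvPowerSeries D S →ₗ[S] _).toAddMonoidHom where
  comm_gamma γ d d' x := by
    rcases eq_or_ne d d' with rfl | h
    · obtain ⟨h0, h1, hcomm⟩ := endoSeries_spec (hex γ)
      -- As γ is a unit, [γ]_Φ has an inverse under composition, so γ_d is an automorphism.
      have hu : IsUnit (PowerSeries.coeff 1 (endoSeries Φ.toSeries (γ : R))) := by
        rw [h1]
        exact γ.isUnit
      have hX : PowerSeries.constantCoeff (PowerSeries.X : R⟦X⟧) = 0 :=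
        PowerSeries.constantCoeff_X
      have hinv := PowerSeries.constantCoeff_substInvOfIsUnit _ hu
      refine tracePsi_comm_equiv Φ d hq hq0 hS hc (gammaAct S Φ γ d)
        (insertAt S (PowerSeries.substInvOfIsUnit _ hu) hinv d) (fun y => ?_) (fun y => ?_)
        (fun y => ?_) x
      · rw [gammaAct, phi, insertAt_comp_self, insertAt_comp_self, insertAt_congr hcomm]
      · rw [gammaAct, insertAt_comp_self,
          insertAt_congr (PowerSeries.subst_substInvOfIsUnit_left _ h0 hu) _ hX,
          insertAt_X_series]
      · rw [gammaAct, insertAt_comp_self,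
          insertAt_congr (PowerSeries.subst_substInvOfIsUnit_right _ h0 hu) _ hX,
          insertAt_X_series]
    · exact tracePsi_comm Φ d hq hq0 hS hc _
        (fun y => insertAt_comm_of_ne _ _ _ _ h.symm y) (insertAt_X_of_ne _ _ h) x
  comm_var d d' h x := by
    -- Since φ_d fixes t_{d'}, this is a case of φ_d-linearity.
    have : phi S Φ d (MvPowerSeries.X d') = MvPowerSeries.X d' := insertAt_X_of_ne _ _ h.symm
    have h2 := tracePsi_phi_mul Φ d hq hq0 hS hc (MvPowerSeries.X d') x
    rwa [this] at h2
  comm_phi d d' h x := tracePsi_comm Φ d hq hq0 hS hc _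
    (fun y => insertAt_comm_of_ne _ _ _ _ h.symm y) (insertAt_X_of_ne _ _ h) x
  phi_mul d b x := tracePsi_phi_mul Φ d hq hq0 hS hc b x

end PsiOperator

/-! ### Transfer of adic completeness -/

section AdicTransfer

variable {S M : Type*} [CommRing S] [AddCommGroup M] [Module S M]

namespace IsTorsionFreeComplete

theorem of_isAdicComplete {a : S} (ha : ∀ x : S, a * x = 0 → x = 0)
    (h : IsAdicComplete (Ideal.span {a}) S) : IsTorsionFreeComplete a S where
  eq_zero_of_smul := ha
  eq_zero_of_forall_pow x hx := h.toIsHausdorff.haus x fun n => by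
    obtain ⟨y, rfl⟩ := hx n
    rw [SModEq.zero, smul_eq_mul, Ideal.mul_top, Ideal.span_singleton_pow,
      Ideal.mem_span_singleton]
    exact dvd_mul_right _ _
  exists_sum r := by
    obtain ⟨s, hs⟩ := h.toIsPrecomplete.prec (f := fun n => ∑ i ∈ Finset.range n, a ^ i * r i) (by
      intro m n hmn
      rw [SModEq.sub_mem, smul_eq_mul, Ideal.mul_top, Ideal.span_singleton_pow,
        Ideal.mem_span_singleton, ← dvd_neg, neg_sub,
        ← Finset.sum_sdiff (Finset.range_subset_range.mpr hmn), add_sub_cancel_right]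
      refine Finset.dvd_sum fun i hi => Dvd.dvd.mul_right (pow_dvd_pow a ?_) _
      simp only [Finset.mem_sdiff, Finset.mem_range, not_lt] at hi
      exact hi.2)
    refine ⟨s, fun n => ?_⟩
    have := hs n
    rw [SModEq.sub_mem, smul_eq_mul, Ideal.mul_top, Ideal.span_singleton_pow,
      Ideal.mem_span_singleton, ← dvd_neg, neg_sub] at this
    obtain ⟨y, hy⟩ := this
    exact ⟨y, by rw [smul_eq_mul, ← hy]; simp⟩

theorem congr {N : Type*} [AddCommGroup N] [Module S N] {a : S} (h : IsTorsionFreeComplete a M)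
    (e : N ≃ₗ[S] M) : IsTorsionFreeComplete a N where
  eq_zero_of_smul x hx := e.map_eq_zero_iff.mp (h.eq_zero_of_smul _ (by
    rw [← map_smul, hx, map_zero]))
  eq_zero_of_forall_pow x hx := e.map_eq_zero_iff.mp (h.eq_zero_of_forall_pow _ fun n => by
    obtain ⟨y, rfl⟩ := hx n
    exact ⟨e y, map_smul e _ _⟩)
  exists_sum r := by
    obtain ⟨s, hs⟩ := h.exists_sum fun n => e (r n)
    refine ⟨e.symm s, fun n => ?_⟩
    obtain ⟨y, hy⟩ := hs n
    exact ⟨e.symm y, by rw [hy]; simp⟩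

theorem of_free {a : S} (h : IsTorsionFreeComplete a S) [Module.Free S M] [Module.Finite S M] :
    IsTorsionFreeComplete a M := by
  cases subsingleton_or_nontrivial S
  · have : Subsingleton M := Module.subsingleton S M
    exact ⟨fun _ _ => Subsingleton.elim _ _, fun _ _ => Subsingleton.elim _ _,
      fun _ => ⟨0, fun _ => ⟨0, Subsingleton.elim _ _⟩⟩⟩
  · exact (h.pi _).congr (Module.finBasis S M).equivFun

theorem algebraMap {T : Type*} [CommRing T] [Algebra S T] {a : S}
    (h : IsTorsionFreeComplete a T) : IsTorsionFreeComplete (algebraMap S T a) T where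
  eq_zero_of_smul x hx := h.eq_zero_of_smul x (by rwa [algebraMap_smul] at hx)
  eq_zero_of_forall_pow x hx := h.eq_zero_of_forall_pow x fun n => by
    obtain ⟨y, hy⟩ := hx n
    exact ⟨y, by rwa [← map_pow, algebraMap_smul] at hy⟩
  exists_sum r := by
    obtain ⟨s, hs⟩ := h.exists_sum r
    refine ⟨s, fun n => ?_⟩
    obtain ⟨y, hy⟩ := hs n
    exact ⟨y, by simpa only [← map_pow, algebraMap_smul] using hy⟩

/-- The two adic topologies agree: a series in b is cut into blocks of length e, and b^e = av makes
it a series in a. -/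
theorem of_dvd_of_dvd_pow {a b : S} (h : IsTorsionFreeComplete a M) (hba : b ∣ a) {e : ℕ}
    (he : 0 < e) (hab : a ∣ b ^ e) : IsTorsionFreeComplete b M where
  eq_zero_of_smul x hx := h.eq_zero_of_smul x (by
    obtain ⟨w, rfl⟩ := hba
    rw [mul_comm, mul_smul, hx, smul_zero])
  eq_zero_of_forall_pow _ hx := h.eq_zero_of_forall_pow _ fun n => by
    obtain ⟨v, hv⟩ := hab
    obtain ⟨y, hy⟩ := hx (e * n)
    exact ⟨v ^ n • y, by rw [hy, smul_smul, ← mul_pow, ← hv, pow_mul]⟩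
  exists_sum r := by
    obtain ⟨v, hv⟩ := hab
    obtain ⟨w, hw⟩ := hba
    obtain ⟨s, hs⟩ := h.exists_sum fun j => v ^ j • ∑ i ∈ Finset.range e, b ^ i • r (e * j + i)
    have hblock : ∀ n, ∑ j ∈ Finset.range n,
        a ^ j • v ^ j • ∑ i ∈ Finset.range e, b ^ i • r (e * j + i) =
        ∑ i ∈ Finset.range (e * n), b ^ i • r i := by
      intro n
      induction n with
      | zero => simp
      | succ n ih =>
        rw [Finset.sum_range_succ, ih, mul_add, mul_one, Finset.sum_range_add, smul_smul, ← mul_pow,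
          ← hv, Finset.smul_sum, ← pow_mul]
        simp only [smul_smul, ← pow_add]
    refine ⟨s, fun n => ?_⟩
    obtain ⟨y, hy⟩ := hs n
    obtain ⟨k, hk⟩ : ∃ k, e * n = n + k := ⟨e * n - n, by
      have := Nat.le_mul_of_pos_left n he
      omega⟩
    -- The first n blocks contain en ≥ n terms; the surplus terms join the remainder.
    refine ⟨∑ i ∈ Finset.range k, b ^ i • r (n + i) + w ^ n • y, ?_⟩
    rw [hy, hblock, hk, Finset.sum_range_add, hw, mul_pow, mul_smul, smul_add, Finset.smul_sum,
      add_assoc]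
    simp only [smul_smul, ← pow_add]

end IsTorsionFreeComplete

end AdicTransfer

/-! ### Rings of integers of p-adic fields -/

section IntClosureInstances

variable (A L : Type*) [CommRing A] [Field L] [Algebra A L]

instance : IsIntegralClosure (IntClosure A L) A L :=
  inferInstanceAs (IsIntegralClosure (integralClosure A L) A L)

instance : IsDomain (IntClosure A L) :=
  inferInstanceAs (IsDomain (integralClosure A L))

instance (M : Type*) [CommRing M] [Algebra L M] : IsScalarTower (IntClosure A L) L M :=
  inferInstanceAs (IsScalarTower (integralClosure A L) L M)

instance : IsScalarTower A (IntClosure A L) L :=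
  inferInstanceAs (IsScalarTower A (integralClosure A L) L)

end IntClosureInstances

/-- The order of a finite ring is zero in that ring; for an infinite quotient `Nat.card` is 0. -/
theorem dvd_card_quotient {R : Type*} [CommRing R] (π : R) :
    π ∣ (Nat.card (R ⧸ Ideal.span {π}) : R) := by
  rw [← Ideal.mem_span_singleton, ← Ideal.Quotient.eq_zero_iff_mem, map_natCast]
  rcases finite_or_infinite (R ⧸ Ideal.span {π}) with h | h
  · cases nonempty_fintype (R ⧸ Ideal.span {π})
    rw [Nat.card_eq_fintype_card, Nat.cast_card_eq_zero]
  · simp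

section Padic

variable (p : ℕ) [Fact p.Prime]

theorem PadicInt.isTorsionFreeComplete : IsTorsionFreeComplete (p : ℤ_[p]) ℤ_[p] :=
  .of_isAdicComplete (fun _ hx => (mul_eq_zero.mp hx).resolve_left
    (Nat.cast_ne_zero.mpr (Fact.out : p.Prime).ne_zero))
    (PadicInt.maximalIdeal_eq_span_p (p := p) ▸ inferInstance)

variable (F : Type*) [Field F] [Algebra ℚ_[p] F] [FiniteDimensional ℚ_[p] F]
  [Algebra ℤ_[p] F] [IsScalarTower ℤ_[p] ℚ_[p] F]

include p in
theorem charZero_of_algebra_padic (F : Type*) [Field F] [Algebra ℚ_[p] F] : CharZero F :=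
  charZero_of_injective_algebraMap (algebraMap ℚ_[p] F).injective

instance : Module.IsTorsionFree ℤ_[p] F := by
  have : FaithfulSMul ℤ_[p] F := by
    rw [faithfulSMul_iff_algebraMap_injective, IsScalarTower.algebraMap_eq ℤ_[p] ℚ_[p] F]
    exact (algebraMap ℚ_[p] F).injective.comp (IsFractionRing.injective ℤ_[p] ℚ_[p])
  infer_instance

instance : Module.Finite ℤ_[p] (ringInt p F) := IsIntegralClosure.finite ℤ_[p] ℚ_[p] F _

instance : Module.Free ℤ_[p] (ringInt p F) := IsIntegralClosure.module_free ℤ_[p] ℚ_[p] F _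

instance : IsNoetherianRing (ringInt p F) := IsIntegralClosure.isNoetherianRing ℤ_[p] ℚ_[p] F _

instance : IsFractionRing (ringInt p F) F :=
  IsIntegralClosure.isFractionRing_of_finite_extension ℤ_[p] ℚ_[p] F _

/-- The spectral norm is multiplicative, and norm at most 1 forces the minimal polynomial to have
coefficients in ℤ_p. This makes the integers of F a valuation ring. -/
theorem isIntegral_or_isIntegral_inv (x : F) : IsIntegral ℤ_[p] x ∨ IsIntegral ℤ_[p] x⁻¹ := by
  have key : ∀ x : F, spectralNorm ℚ_[p] F x ≤ 1 → IsIntegral ℤ_[p] x := by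
    intro x hx
    have hint : IsIntegral ℚ_[p] x := Algebra.IsIntegral.isIntegral x
    have hc := (spectralValue_le_one_iff (minpoly.monic hint)).mp hx
    have hl : minpoly ℚ_[p] x ∈ Polynomial.lifts (algebraMap ℤ_[p] ℚ_[p]) := by
      rw [Polynomial.lifts_iff_coeff_lifts]
      exact fun n => ⟨⟨_, hc n⟩, rfl⟩
    obtain ⟨P, hP, -, hmonic⟩ := Polynomial.lifts_and_degree_eq_and_monic hl (minpoly.monic hint)
    refine ⟨P, hmonic, ?_⟩
    rw [IsScalarTower.algebraMap_eq ℤ_[p] ℚ_[p] F, ← Polynomial.eval₂_map, hP]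
    exact minpoly.aeval _ _
  rcases eq_or_ne x 0 with rfl | hx
  · exact Or.inl isIntegral_zero
  have hmul : spectralNorm ℚ_[p] F x * spectralNorm ℚ_[p] F x⁻¹ = 1 := by
    have h := map_mul (spectralMulAlgNorm ℚ_[p] F) x x⁻¹
    rw [mul_inv_cancel₀ hx, map_one] at h
    exact h.symm
  by_cases h : spectralNorm ℚ_[p] F x ≤ 1
  · exact Or.inl (key x h)
  · refine Or.inr (key _ ?_)
    by_contra h'
    push Not at h h'
    exact (one_lt_mul h.le h').ne' hmul

instance : ValuationRing (ringInt p F) := by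
  rw [ValuationRing.iff_isInteger_or_isInteger _ F]
  intro x
  have key : ∀ x : F, IsIntegral ℤ_[p] x → IsLocalization.IsInteger (ringInt p F) x := by
    intro x hx
    obtain ⟨y, hy⟩ := (IsIntegralClosure.isIntegral_iff (A := ringInt p F)).mp hx
    exact ⟨y, hy⟩
  exact (isIntegral_or_isIntegral_inv p F x).imp (key x) (key _)

instance : IsPrincipalIdealRing (ringInt p F) :=
  IsPrincipalIdealRing.of_isNoetherianRing_of_isBezout

theorem not_isUnit_natCast_ringInt : ¬ IsUnit (p : ringInt p F) := by
  intro h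
  have : FaithfulSMul ℤ_[p] (ringInt p F) := inferInstance
  have hu : IsUnit (algebraMap ℤ_[p] (ringInt p F) p) := by rwa [map_natCast]
  have hi : Algebra.IsIntegral ℤ_[p] (ringInt p F) := inferInstance
  have := isUnit_of_map_unit (algebraMap ℤ_[p] (ringInt p F)) _ hu
  exact PadicInt.p_nonunit this

theorem natCast_ringInt_ne_zero (F : Type*) [Field F] [Algebra ℚ_[p] F] [Algebra ℤ_[p] F] :
    (p : ringInt p F) ≠ 0 := by
  have := charZero_of_algebra_padic p F
  intro h
  have h' := congrArg (algebraMap (ringInt p F) F) h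
  rw [map_natCast, map_zero, Nat.cast_eq_zero] at h'
  exact (Fact.out : p.Prime).ne_zero h'

instance : IsDiscreteValuationRing (ringInt p F) where
  not_a_field' h := by
    have h1 : (p : ringInt p F) ∈ IsLocalRing.maximalIdeal (ringInt p F) :=
      not_isUnit_natCast_ringInt p F
    rw [h] at h1
    exact natCast_ringInt_ne_zero p F h1

/-- The integers of F are free over ℤ_p of rank [F : ℚ_p], so the quotient is a vector space of that
dimension over the field with p elements. -/
theorem card_quotient_span_natCast :
    Nat.card (ringInt p F ⧸ Ideal.span {(p : ringInt p F)}) = p ^ Module.finrank ℚ_[p] F := by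
  have hmap : Ideal.span {(p : ringInt p F)} =
      (IsLocalRing.maximalIdeal ℤ_[p]).map (algebraMap ℤ_[p] (ringInt p F)) := by
    rw [PadicInt.maximalIdeal_eq_span_p, Ideal.map_span, Set.image_singleton, map_natCast]
  have hcard : Nat.card (IsLocalRing.ResidueField ℤ_[p]) = p := by
    rw [Nat.card_congr PadicInt.residueField.toEquiv, Nat.card_zmod]
  have : Module.Finite (ℤ_[p] ⧸ IsLocalRing.maximalIdeal ℤ_[p]) (ringInt p F ⧸
      (IsLocalRing.maximalIdeal ℤ_[p]).map (algebraMap ℤ_[p] (ringInt p F))) :=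
    Module.Finite.of_restrictScalars_finite ℤ_[p] _ _
  let : Field (ℤ_[p] ⧸ IsLocalRing.maximalIdeal ℤ_[p]) := Ideal.Quotient.field _
  rw [hmap, Module.natCard_eq_pow_finrank (K := ℤ_[p] ⧸ IsLocalRing.maximalIdeal ℤ_[p]),
    IsLocalRing.finrank_quotient_map, IsIntegralClosure.rank ℤ_[p] ℚ_[p] F]
  exact congrArg (· ^ _) hcard

variable {p F} {π : ringInt p F}

theorem finite_quotient_of_dvd_natCast (hp : π ∣ (p : ringInt p F)) :
    Finite (ringInt p F ⧸ Ideal.span {π}) := by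
  have : Finite (ringInt p F ⧸ Ideal.span {(p : ringInt p F)}) := by
    apply Nat.finite_of_card_ne_zero
    rw [card_quotient_span_natCast]
    exact pow_ne_zero _ (Fact.out : p.Prime).ne_zero
  exact Finite.of_surjective _
    (Ideal.Quotient.factor_surjective (Ideal.span_singleton_le_span_singleton.mpr hp))

theorem dvd_natCast_of_irreducible (hπ : Irreducible π) : π ∣ (p : ringInt p F) := by
  rw [← Ideal.mem_span_singleton, ← hπ.maximalIdeal_eq]
  exact not_isUnit_natCast_ringInt p F

theorem card_quotient_eq_prime_pow (hπ : Irreducible π) :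
    ∃ f : ℕ, 0 < f ∧ Nat.card (ringInt p F ⧸ Ideal.span {π}) = p ^ f := by
  have hp := dvd_natCast_of_irreducible hπ
  have := finite_quotient_of_dvd_natCast hp
  have := PrincipalIdealRing.isMaximal_of_irreducible hπ
  let : Field (ringInt p F ⧸ Ideal.span {π}) := Ideal.Quotient.field _
  cases nonempty_fintype (ringInt p F ⧸ Ideal.span {π})
  have hchar : CharP (ringInt p F ⧸ Ideal.span {π}) p := by
    obtain ⟨r, hr⟩ := CharP.exists (ringInt p F ⧸ Ideal.span {π})
    have h0 : (p : ringInt p F ⧸ Ideal.span {π}) = 0 := by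
      rw [← map_natCast (Ideal.Quotient.mk _), Ideal.Quotient.eq_zero_iff_mem,
        Ideal.mem_span_singleton]
      exact hp
    rcases (Nat.dvd_prime Fact.out).mp ((CharP.cast_eq_zero_iff _ r p).mp h0) with rfl | rfl
    · exact absurd rfl (CharP.char_ne_one (ringInt p F ⧸ Ideal.span {π}) 1)
    · exact hr
  obtain ⟨n, -, hn⟩ := FiniteField.card (ringInt p F ⧸ Ideal.span {π}) p
  exact ⟨n, n.pos, by rw [Nat.card_eq_fintype_card, hn]⟩

/-- Outside the case `F = ℚ_p`, the quotient `q / π` is divisible by `π`. -/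
theorem dvd_of_finrank_ne_one (hπ : Irreducible π) {c : ringInt p F}
    (hc : π * c = (Nat.card (ringInt p F ⧸ Ideal.span {π}) : ringInt p F))
    (hF : Module.finrank ℚ_[p] F ≠ 1) : π ∣ c := by
  by_contra hdvd
  have hp := dvd_natCast_of_irreducible hπ
  obtain ⟨f, hf0, hf⟩ := card_quotient_eq_prime_pow hπ
  have hu : IsUnit c := by
    rwa [← Ideal.mem_span_singleton, ← hπ.maximalIdeal_eq, IsLocalRing.mem_maximalIdeal,
      mem_nonunits_iff, not_not] at hdvd
  rw [hf, Nat.cast_pow] at hc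
  obtain ⟨g, rfl⟩ : ∃ g, f = g + 1 := ⟨f - 1, by omega⟩
  -- If q = p, a unit c gives (π) = (p), and counting forces [F : ℚ_p] = 1. Otherwise π² divides q =
  -- πc.
  rcases Nat.eq_zero_or_pos g with rfl | hg
  · rw [zero_add, pow_one] at hc
    have hspan : Ideal.span {π} = Ideal.span {(p : ringInt p F)} := by
      rw [← hc, Ideal.span_singleton_mul_right_unit hu]
    rw [hspan, card_quotient_span_natCast] at hf
    exact hF (Nat.pow_right_injective (Fact.out : p.Prime).two_le hf)
  · apply hdvd
    have h2 : π * π ∣ π * c := by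
      rw [hc, pow_succ]
      exact mul_dvd_mul (hp.trans (dvd_pow_self _ hg.ne')) hp
    exact (mul_dvd_mul_iff_left hπ.ne_zero).mp h2

/-- For `F = ℚ_p`, the quotient `q / π` is a unit. -/
theorem isUnit_of_finrank_eq_one (hπ : Irreducible π) {c : ringInt p F}
    (hc : π * c = (Nat.card (ringInt p F ⧸ Ideal.span {π}) : ringInt p F))
    (hF : Module.finrank ℚ_[p] F = 1) : IsUnit c := by
  have hp := dvd_natCast_of_irreducible hπ
  obtain ⟨f, hf0, hf⟩ := card_quotient_eq_prime_pow hπ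
  have hcard := card_quotient_span_natCast p F
  rw [hF, pow_one] at hcard
  have : Finite (ringInt p F ⧸ Ideal.span {(p : ringInt p F)}) :=
    Nat.finite_of_card_ne_zero (by rw [hcard]; exact (Fact.out : p.Prime).ne_zero)
  have hle : Ideal.span {(p : ringInt p F)} ≤ Ideal.span {π} :=
    Ideal.span_singleton_le_span_singleton.mpr hp
  have hple : p ≤ p ^ f := Nat.le_self_pow hf0.ne' p
  -- The quotient by p has only p elements but surjects onto the p^f elements of the quotient by π,
  -- so (π) = (p).
  have hbij := (Ideal.Quotient.factor_surjective hle).bijective_of_nat_card_le (by rwa [hcard, hf])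
  have hqp : p ^ f = p := by
    rw [← hf, ← Nat.card_congr (Equiv.ofBijective _ hbij), hcard]
  rw [hf, hqp] at hc
  have hmem : Ideal.Quotient.mk (Ideal.span {(p : ringInt p F)}) π = 0 := by
    apply hbij.1
    rw [map_zero, Ideal.Quotient.factor_mk, Ideal.Quotient.eq_zero_iff_mem]
    exact Ideal.mem_span_singleton_self π
  rw [Ideal.Quotient.eq_zero_iff_mem, Ideal.mem_span_singleton, ← hc] at hmem
  exact isUnit_of_dvd_one ((mul_dvd_mul_iff_left hπ.ne_zero).mp (by rwa [mul_one]))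

theorem isUnit_one_sub_pow (hπ : Irreducible π) {n : ℕ} (hn : 0 < n) : IsUnit (1 - π ^ n) :=
  IsLocalRing.isUnit_one_sub_self_of_mem_nonunits _ fun h =>
    hπ.not_isUnit (isUnit_of_dvd_unit (dvd_pow_self π hn.ne') h)

/-- Completeness at p comes from freeness over ℤ_p, and passes to π because p is associated to a
power of π. -/
theorem isTorsionFreeComplete_ringInt (hπ : Irreducible π) :
    IsTorsionFreeComplete π (ringInt p F) := by
  have h := ((PadicInt.isTorsionFreeComplete p).of_free (M := ringInt p F)).algebraMap
  rw [map_natCast] at h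
  obtain ⟨e, he⟩ := IsDiscreteValuationRing.associated_pow_irreducible
    (natCast_ringInt_ne_zero p F) hπ
  refine h.of_dvd_of_dvd_pow (dvd_natCast_of_irreducible hπ) (e := e) ?_ he.dvd
  rcases Nat.eq_zero_or_pos e with rfl | h0
  · rw [pow_zero, associated_one_iff_isUnit] at he
    exact absurd he (not_isUnit_natCast_ringInt p F)
  · exact h0

variable (p F) (K : Type*) [Field K] [Algebra F K] [FiniteDimensional F K]

instance : Module.IsTorsionFree (ringInt p F) K := by
  have : FaithfulSMul (ringInt p F) K := by
    rw [faithfulSMul_iff_algebraMap_injective, IsScalarTower.algebraMap_eq (ringInt p F) F K]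
    exact (algebraMap F K).injective.comp (IsFractionRing.injective (ringInt p F) F)
  infer_instance

theorem isSeparable_of_algebra_padic (p : ℕ) [Fact p.Prime] (F K : Type*) [Field F] [Field K]
    [Algebra ℚ_[p] F] [Algebra F K] [FiniteDimensional F K] : Algebra.IsSeparable F K := by
  have := charZero_of_algebra_padic p F
  infer_instance

instance : Module.Finite (ringInt p F) (ringIntExt p F K) :=
  have := isSeparable_of_algebra_padic p F K
  IsIntegralClosure.finite (ringInt p F) F K _

instance : Module.Free (ringInt p F) (ringIntExt p F K) :=
  have := isSeparable_of_algebra_padic p F K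
  IsIntegralClosure.module_free (ringInt p F) F K _

instance : IsNoetherianRing (ringIntExt p F K) :=
  have := isSeparable_of_algebra_padic p F K
  IsIntegralClosure.isNoetherianRing (ringInt p F) F K _

variable {p F}

theorem isTorsionFreeComplete_ringIntExt (hπ : Irreducible π) :
    IsTorsionFreeComplete (algebraMap (ringInt p F) (ringIntExt p F K) π) (ringIntExt p F K) :=
  ((isTorsionFreeComplete_ringInt hπ).of_free).algebraMap

end Padic

end

/-! ### The trace operator over A and its normalization -/

theorem mainTheorem3 (p : ℕ) [Fact p.Prime]
    (F : Type*) [Field F] [Algebra ℚ_[p] F] [FiniteDimensional ℚ_[p] F]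
    [Algebra ℤ_[p] F] [IsScalarTower ℤ_[p] ℚ_[p] F]
    (K : Type*) [Field K] [Algebra F K] [FiniteDimensional F K]
    (π : ringInt p F) (hπ : Irreducible π)
    (q : ℕ) (hq : q = Nat.card (ringInt p F ⧸ Ideal.span {π}))
    (Φ : LubinTateSeries π)
    (I : Ideal (ringIntExt p F K)) [Finite (ringIntExt p F K ⧸ I)]
    (D : Type*) [Finite D] [DecidableEq D] :
    -- the trace of `𝓞_K[[t]]` over `φ_d(𝓞_K[[t]])` is that of a free module of rank `q`
    (∀ d : D,
      Module.Free (phi (ringIntExt p F K) Φ d).range (MvPowerSeries D (ringIntExt p F K)) ∧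
      Module.finrank (phi (ringIntExt p F K) Φ d).range
        (MvPowerSeries D (ringIntExt p F K)) = q) ∧
    (∃ ψ : D → MvPowerSeries D (ringIntExt p F K ⧸ I) →+ MvPowerSeries D (ringIntExt p F K ⧸ I),
      IsPsiOperator Φ ψ ∧
      (∀ d, Function.Surjective (ψ d)) ∧
      -- `ψ_d` is the reduction of `π⁻¹ φ_d⁻¹ ∘ trace`
      (∀ (d : D) (x : MvPowerSeries D (ringIntExt p F K)),
        ∃ y : MvPowerSeries D (ringIntExt p F K),
          (Algebra.trace (phi (ringIntExt p F K) Φ d).range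
              (MvPowerSeries D (ringIntExt p F K)) x : MvPowerSeries D (ringIntExt p F K)) =
            MvPowerSeries.C (algebraMap (ringInt p F) (ringIntExt p F K) π) *
              phi (ringIntExt p F K) Φ d y ∧
          ψ d (MvPowerSeries.map (Ideal.Quotient.mk I) x) =
            MvPowerSeries.map (Ideal.Quotient.mk I) y) ∧
      -- the explicit formulas modulo `π` for `Φ = π t + t ^ q`
      (Φ.toSeries = PowerSeries.C π * PowerSeries.X + PowerSeries.X ^ q →
        ∃ c : ringInt p F, π * c = (q : ringInt p F) ∧
        ∀ (d : D) (m i : ℕ), i ≤ q - 1 →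
          MvPowerSeries.C (algebraMap (ringInt p F) (ringIntExt p F K ⧸ I) π) ∣
            ψ d (MvPowerSeries.X d ^ (m * q + i)) -
              (if i = q - 1 then MvPowerSeries.X d ^ m
               else if i = 0 ∧ Module.finrank ℚ_[p] F = 1 then
                 MvPowerSeries.C (algebraMap (ringInt p F) (ringIntExt p F K ⧸ I) c) *
                   MvPowerSeries.X d ^ m
               else 0))) ∧
    -- for `F = ℚ_p` the operator can be normalized so that `ψ_d` fixes `t_{d'}` for `d' ≠ d`
    (Module.finrank ℚ_[p] F = 1 →
      ∃ ψ : D → MvPowerSeries D (ringIntExt p F K ⧸ I) →+ MvPowerSeries D (ringIntExt p F K ⧸ I),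
        IsPsiOperator Φ ψ ∧ (∀ d, Function.Surjective (ψ d)) ∧
        ∀ d d' : D, d ≠ d' → ψ d (MvPowerSeries.X d') = MvPowerSeries.X d') := by
  subst hq
  have hp := dvd_natCast_of_irreducible hπ
  have hfin := finite_quotient_of_dvd_natCast hp
  have hmax := PrincipalIdealRing.isMaximal_of_irreducible hπ
  have hq1 : 1 < Nat.card (ringInt p F ⧸ Ideal.span {π}) := by
    have := Ideal.Quotient.nontrivial_iff.mpr hmax.ne_top
    exact Finite.one_lt_card
  have hq0 := zero_lt_one.trans hq1
  have hS := isTorsionFreeComplete_ringIntExt K hπ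
  have hI : I.FG := IsNoetherian.noetherian I
  obtain ⟨c, hc'⟩ := dvd_card_quotient π
  have hc := hc'.symm
  have hex : ∀ γ : ringInt p F, ∃ f, IsEndoSeries Φ.toSeries γ f := by
    let : Field (ringInt p F ⧸ Ideal.span {π}) := Ideal.Quotient.field _
    exact exists_isEndoSeries Φ (fun n hn => isUnit_one_sub_pow hπ hn)
      FiniteField.powerSeries_pow_card
  have hψ := isPsiOperator_tracePsi (D := D) Φ rfl hq0 hS hc hex
  refine ⟨fun d => ⟨.of_basis (phiBasis Φ d rfl hq0 hS), ?_⟩,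
    ⟨fun d => quotMap I hI (tracePsi Φ d rfl hq0 hS hc), isPsiOperator_quotMap Φ I hI _ hψ,
      fun d => quotMap_surjective I hI (tracePsi_surjective Φ d rfl hq0 hS hc hq1),
      fun d x => ⟨tracePsi Φ d rfl hq0 hS hc x, trace_eq_C_mul_phi_tracePsi Φ d rfl hq0 hS hc x,
        quotMap_map I hI _ x⟩, fun hΦ => ⟨c, hc, fun d m i hi => ?_⟩⟩, fun hF => ?_⟩
  · have : Nontrivial (phi (ringIntExt p F K) Φ d).range := inferInstance
    rw [Module.finrank_eq_card_basis (phiBasis Φ d rfl hq0 hS), Fintype.card_fin]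
  · obtain ⟨w, hw⟩ := tracePsi_X_pow (S := ringIntExt p F K) Φ d rfl hq0 hS hc hq1 hΦ m i (by omega)
    have hmapπ : MvPowerSeries.map (σ := D) (Ideal.Quotient.mk I)
        (MvPowerSeries.C (algebraMap (ringInt p F) (ringIntExt p F K) π)) =
        MvPowerSeries.C (algebraMap (ringInt p F) (ringIntExt p F K ⧸ I) π) :=
      MvPowerSeries.map_C _ _
    have hmapc : MvPowerSeries.map (σ := D) (Ideal.Quotient.mk I)
        (MvPowerSeries.C (algebraMap (ringInt p F) (ringIntExt p F K) c)) =
        MvPowerSeries.C (algebraMap (ringInt p F) (ringIntExt p F K ⧸ I) c) :=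
      MvPowerSeries.map_C _ _
    rw [← MvPowerSeries.map_X (Ideal.Quotient.mk I), ← map_pow, quotMap_map, mul_comm m, hw,
      ← hmapπ, ← hmapc, ← map_pow, ← map_mul]
    simp only [MvPowerSeries.smul_eq_C_mul]
    by_cases h1 : i = Nat.card (ringInt p F ⧸ Ideal.span {π}) - 1
    · rw [if_pos h1, if_pos h1, ← map_sub, add_sub_cancel_left]
      exact map_dvd _ (dvd_mul_right _ _)
    · rw [if_neg h1, if_neg h1]
      by_cases h2 : i = 0
      · by_cases h3 : Module.finrank ℚ_[p] F = 1
        · rw [if_pos h2, if_pos ⟨h2, h3⟩, ← map_sub, add_sub_cancel_left]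
          exact map_dvd _ (dvd_mul_right _ _)
        · rw [if_pos h2, if_neg (fun h => h3 h.2), sub_zero]
          -- For F ≠ ℚ_p the value q/π at i = 0 itself vanishes modulo π.
          have hdvd := dvd_of_finrank_ne_one hπ hc h3
          exact map_dvd _ (dvd_add ((map_dvd _ (map_dvd _ hdvd)).mul_right _) (dvd_mul_right _ _))
      · rw [if_neg h2, if_neg (fun h => h2 h.1), sub_zero, zero_add]
        exact map_dvd _ (dvd_mul_right _ _)
  · have hu : IsUnit (algebraMap (ringInt p F) (ringIntExt p F K) c) :=
      (isUnit_of_finrank_eq_one hπ hc hF).map _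
    -- Scaling by v = (q/π)⁻¹ makes ψ_d(1) = 1, hence ψ_d(t_{d'}) = t_{d'}ψ_d(1) = t_{d'}.
    obtain ⟨v, hv⟩ := hu.exists_left_inv
    have hψv := hψ.smul Φ v
    refine ⟨fun d => quotMap I hI (v • tracePsi Φ d rfl hq0 hS hc),
      isPsiOperator_quotMap Φ I hI _ hψv, fun d => quotMap_surjective I hI fun x => ?_,
      fun d d' h => ?_⟩
    · obtain ⟨y, hy⟩ := tracePsi_surjective Φ d rfl hq0 hS hc hq1
        (algebraMap (ringInt p F) (ringIntExt p F K) c • x)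
      exact ⟨y, by rw [LinearMap.smul_apply, hy, smul_smul, hv, one_smul]⟩
    · have h1 := hψv.comm_var d d' h 1
      have h2 : (v • tracePsi Φ d rfl hq0 hS hc) (1 : MvPowerSeries D (ringIntExt p F K)) = 1 := by
        rw [LinearMap.smul_apply, tracePsi_one, MvPowerSeries.smul_eq_C_mul, ← map_mul, hv, map_one]
      have h3 : (v • tracePsi Φ d rfl hq0 hS hc)
          (MvPowerSeries.X d' : MvPowerSeries D (ringIntExt p F K)) = MvPowerSeries.X d' := by
        rw [mul_one] at h1
        exact h1.trans ((congrArg _ h2).trans (mul_one _))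
      rw [← MvPowerSeries.map_X (Ideal.Quotient.mk I), quotMap_map, h3]
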